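/- Let $\mu>0$ and $0<q<1$, and consider global $C^2$ solutions $w:\mathbb R\to\mathbb R$ of $$w''+\mu w=w|w|^{q-1},\qquad (*)$$ where the right-hand side is $0$ when $w=0$. Call a solution \emph{of mode $k$}, $k\ge 1$ an integer, if its least positive period exists and equals $2\pi/k$; call it \emph{sign changing} if it takes both positive and negative values, \emph{positive} (\emph{nonnegative}) if $w(t)>0$ ($w(t)\ge 0$) for all $t$. Uniqueness is understood up to translations of the variable $t$. 1. Equation $(*)$ has a nonconstant sign-changing $2\pi$-periodic solution if and only if $\mu>1$. For each integer $k$ with $\frac{1-q}{2}\sqrt\mu<k<\sqrt\mu$ there is a sign-changing solution of mode $k$, and it is unique up to sign. 2. Equation $(*)$ has a nonconstant positive $2\pi$-periodic solution if and only if there is an integer $k$ with $(1-q)\sqrt\mu<k<\sqrt{\mu(1-q)}$. For an integer $k\ge1$, a positive solution of mode $k$ exists if and only if $(1-q)\sqrt\mu<k<\sqrt{\mu(1-q)}$, and in that case it is unique. 3. There is a unique nonnegative solution of $(*)$ with least positive period $L=\frac{2\pi}{(1-q)\sqrt\mu}$. It vanishes exactly once in each half-open interval of length $L$, and its orbit $\{(w(t),w'(t)):t\in\mathbb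 R\}$ is $$\Big\{(x,y)\in\mathbb R^2:\ x\ge 0,\ y^2+\mu x^2=\tfrac{2}{1+q}|x|^{1+q}\Big\}.$$ -/

import Mathlib

/-- `w : ℝ → ℝ` is a (classical, global) solution of `w'' + μ w = ε w |w|^(q-1)`. For `0 < q` the
right-hand side is `0` where `w` vanishes, also under the convention for `rpow` at base `0`. -/
def IsODESolution (μ ε q : ℝ) (w : ℝ → ℝ) : Prop :=
  ContDiff ℝ 2 w ∧ ∀ t : ℝ, deriv (deriv w) t + μ * w t = ε * (w t * |w t| ^ (q - 1))

/-- `T` is the least positive period of `w` (so `w`, if continuous, is not constant). -/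
def HasLeastPeriod (w : ℝ → ℝ) (T : ℝ) : Prop :=
  IsLeast {S : ℝ | 0 < S ∧ Function.Periodic w S} T

/-- `w` is of mode `k`: its least period is `2π/k` (never the case for `k = 0`). -/
def IsOfMode (w : ℝ → ℝ) (k : ℕ) : Prop :=
  HasLeastPeriod w (2 * Real.pi / k)

/-- `w` takes both positive and negative values. -/
def IsSignChanging (w : ℝ → ℝ) : Prop :=
  (∃ t : ℝ, 0 < w t) ∧ ∃ t : ℝ, w t < 0

/-- `w` is constant. -/
def IsConstantFun (w : ℝ → ℝ) : Prop :=
  ∃ a : ℝ, ∀ t : ℝ, w t = a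

/-- `v` is obtained from `w` by a shift of time. -/
def IsTimeShift (v w : ℝ → ℝ) : Prop :=
  ∃ τ : ℝ, ∀ t : ℝ, v t = w (t + τ)

/-- The orbit of `w` in the phase plane, i.e. the set of the points `(w(t), w'(t))`. -/
def phaseOrbit (w : ℝ → ℝ) : Set (ℝ × ℝ) :=
  Set.range fun t : ℝ => (w t, deriv w t)

/-!
After a change of units `μ = 1`, and the energy `w'² / 2 + w² / 2 - |w|^(1+q) / (1+q)` sorts the
nonconstant periodic solutions: it is negative for the positive ones, positive for the sign-changing
ones, and zero for the nonnegative one that touches `0`, which is explicit. Uniqueness for the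
initial value problem fails only at the origin of the phase plane, where the energy is zero.
As the energy decreases from infinity to zero, the least period of the sign-changing solutions
increases strictly and continuously from `2π` to `4π / (1 - q)`. As it increases from its minimum to
zero, that of the positive solutions increases from `2π / √(1 - q)` to `2π / (1 - q)`. Hence every
period in between is attained exactly once up to time shifts. For the positive solutions the
monotonicity comes from a coordinate that turns the potential well into a parabola, through a bound
on the second derivative of its inverse.
-/

section Periods

variable {v w : ℝ → ℝ} {S T : ℝ}

lemma IsTimeShift.symm (h : IsTimeShift v w) : IsTimeShift w v := by
  obtain ⟨τ, hτ⟩ := h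
  exact ⟨-τ, fun t => by rw [hτ, neg_add_cancel_right]⟩

lemma IsTimeShift.periodic (h : IsTimeShift v w) (hw : Function.Periodic w S) :
    Function.Periodic v S := by
  obtain ⟨τ, hτ⟩ := h
  exact fun t => by rw [hτ, hτ, add_right_comm, hw]

lemma IsTimeShift.hasLeastPeriod (h : IsTimeShift v w) (hw : HasLeastPeriod w T) :
    HasLeastPeriod v T :=
  ⟨⟨hw.1.1, h.periodic hw.1.2⟩, fun _ hS => hw.2 ⟨hS.1, h.symm.periodic hS.2⟩⟩

lemma HasLeastPeriod.not_isConstantFun (h : HasLeastPeriod w T) : ¬ IsConstantFun w := by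
  rintro ⟨a, ha⟩
  have hpos : 0 < T := h.1.1
  have hhalf : T ≤ T / 2 := h.2 ⟨half_pos hpos, fun t => by rw [ha, ha]⟩
  linarith

lemma HasLeastPeriod.exists_eq_nat_mul (h : HasLeastPeriod w T) (hS : 0 < S)
    (hper : Function.Periodic w S) : ∃ n : ℕ, 1 ≤ n ∧ S = n * T := by
  have hT : 0 < T := h.1.1
  set n := ⌊S / T⌋₊
  have hlow : n * T ≤ S := (le_div_iff₀ hT).1 (Nat.floor_le (by positivity))
  have hup : S < (n + 1) * T := (div_lt_iff₀ hT).1 (Nat.lt_floor_add_one _)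
  have hrem : ¬ 0 < S - n * T := fun hpos => by
    have := h.2 ⟨hpos, hper.sub_period (h.1.2.nat_mul n)⟩
    linarith
  have hS' : S = n * T := by linarith
  refine ⟨n, Nat.one_le_iff_ne_zero.2 fun h0 => ?_, hS'⟩
  rw [h0, Nat.cast_zero, zero_mul] at hS'
  exact hS.ne' hS'

lemma IsOfMode.cast_pos {k : ℕ} (hk : IsOfMode w k) : (0 : ℝ) < k :=
  (div_pos_iff_of_pos_left Real.two_pi_pos).1 hk.1.1

lemma IsOfMode.periodic {k : ℕ} (hk : IsOfMode w k) : Function.Periodic w (2 * Real.pi) := by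
  have h : Function.Periodic w (k * (2 * Real.pi / k)) := hk.1.2.nat_mul k
  rwa [mul_div_cancel₀ _ hk.cast_pos.ne'] at h

lemma IsOfMode.unique {k n : ℕ} (hk : IsOfMode w k) (hn : IsOfMode w n) : k = n := by
  have h := IsLeast.unique hk hn
  rw [div_eq_div_iff hk.cast_pos.ne' hn.cast_pos.ne'] at h
  exact_mod_cast (mul_left_cancel₀ Real.two_pi_pos.ne' h).symm

lemma two_mul_le_of_periodic_of_pos_of_neg {α β L : ℝ} (hS : 0 < S) (hper : Function.Periodic w S)
    (hpos : ∀ t ∈ Set.Ioo α (α + L), 0 < w t) (hneg : ∀ t ∈ Set.Ioo β (β + L), w t < 0) :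
    2 * L ≤ S := by
  obtain ⟨n, hn, -⟩ := existsUnique_add_zsmul_mem_Ico hS β α
  have hneg' : ∀ t ∈ Set.Ioo (β + n • S) (β + n • S + L), w t < 0 := fun t ht => by
    rw [← hper.sub_zsmul_eq n]
    exact hneg _ ⟨by linarith [ht.1], by linarith [ht.2]⟩
  have hpos' : ∀ t ∈ Set.Ioo (α + S) (α + S + L), 0 < w t := fun t ht => by
    rw [← hper.sub_eq]
    exact hpos _ ⟨by linarith [ht.1], by linarith [ht.2]⟩
  have hsep {γ : ℝ} (hγ : ∀ t ∈ Set.Ioo γ (γ + L), 0 < w t) :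
      min (γ + L) (β + n • S + L) ≤ max γ (β + n • S) :=
    Set.Ioo_disjoint_Ioo.1 (Set.disjoint_left.2 fun t ht ht' =>
      (hγ t ht).not_gt (hneg' t ht'))
  have hleft := hsep hpos
  have hright := hsep hpos'
  rw [min_eq_left (by linarith [hn.1]), max_eq_right hn.1] at hleft
  rw [min_eq_right (by linarith [hn.2]), max_eq_left hn.2.le] at hright
  linarith

end Periods

/-- `w` is a global solution of Newton's equation `w'' = f(w)`. -/
structure IsNewtonSolution (f w : ℝ → ℝ) : Prop where
  hasDerivAt (t : ℝ) : HasDerivAt w (deriv w t) t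
  hasDerivAt_deriv (t : ℝ) : HasDerivAt (deriv w) (f (w t)) t

/-- The total energy of a unit mass in the potential `U` at position `x` with velocity `y`. -/
noncomputable def energy (U : ℝ → ℝ) (x y : ℝ) : ℝ := y ^ 2 / 2 + U x

namespace IsNewtonSolution

open Set Filter Topology

variable {f U v w : ℝ → ℝ}

lemma of_hasDerivAt {z : ℝ → ℝ} (hw : ∀ t, HasDerivAt w (z t) t)
    (hz : ∀ t, HasDerivAt z (f (w t)) t) : IsNewtonSolution f w := by
  obtain rfl : deriv w = z := funext fun t => (hw t).deriv
  exact ⟨hw, hz⟩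

lemma continuous (hw : IsNewtonSolution f w) : Continuous w :=
  continuous_iff_continuousAt.2 fun t => (hw.hasDerivAt t).continuousAt

lemma continuous_deriv (hw : IsNewtonSolution f w) : Continuous (deriv w) :=
  continuous_iff_continuousAt.2 fun t => (hw.hasDerivAt_deriv t).continuousAt

lemma comp_add_const (hw : IsNewtonSolution f w) (τ : ℝ) :
    IsNewtonSolution f fun t => w (t + τ) :=
  of_hasDerivAt (fun t => (hw.hasDerivAt (t + τ)).comp_add_const t τ)
    fun t => (hw.hasDerivAt_deriv (t + τ)).comp_add_const t τ

lemma comp_neg (hw : IsNewtonSolution f w) : IsNewtonSolution f fun t => w (-t) :=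
  of_hasDerivAt (z := fun t => -deriv w (-t))
    (fun t => ((hw.hasDerivAt (-t)).comp t (hasDerivAt_neg t)).congr_deriv (by ring))
    fun t => ((hw.hasDerivAt_deriv (-t)).comp t (hasDerivAt_neg t)).neg.congr_deriv (by ring)

lemma energy_eq (hU : ∀ x, HasDerivAt U (-f x) x) (hw : IsNewtonSolution f w) (s t : ℝ) :
    energy U (w s) (deriv w s) = energy U (w t) (deriv w t) := by
  have hconst (t : ℝ) : HasDerivAt (fun t => energy U (w t) (deriv w t)) 0 t := by
    have hkin := ((hw.hasDerivAt_deriv t).pow 2).div_const 2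
    have hpot := (hU (w t)).comp t (hw.hasDerivAt t)
    refine (hkin.add hpot).congr_deriv ?_
    simp only [Nat.cast_ofNat]
    ring
  exact is_const_of_deriv_eq_zero (fun t => (hconst t).differentiableAt)
    (fun t => (hconst t).deriv) s t

lemma eventuallyEq_of_contDiffAt (hv : IsNewtonSolution f v) (hw : IsNewtonSolution f w) {t : ℝ}
    (hf : ContDiffAt ℝ 1 f (w t)) (hpos : v t = w t) (hvel : deriv v t = deriv w t) :
    v =ᶠ[𝓝 t] w := by
  let F : ℝ × ℝ → ℝ × ℝ := fun p => (p.2, f p.1)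
  have hF : ContDiffAt ℝ 1 F (w t, deriv w t) :=
    contDiffAt_snd.prodMk (hf.comp (w t, deriv w t) contDiffAt_fst)
  obtain ⟨K, s, hs, hK⟩ := hF.exists_lipschitzOnWith
  have hflow (u : ℝ → ℝ) (hu : IsNewtonSolution f u) (hs : s ∈ 𝓝 (u t, deriv u t)) :
      ∀ᶠ x in 𝓝 t, HasDerivAt (fun x => (u x, deriv u x)) (F (u x, deriv u x)) x ∧
        (u x, deriv u x) ∈ s := by
    filter_upwards [(hu.continuous.prodMk hu.continuous_deriv).continuousAt hs] with x hx
    exact ⟨(hu.hasDerivAt x).prodMk (hu.hasDerivAt_deriv x), hx⟩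
  have hphase := ODE_solution_unique_of_eventually (v := fun _ => F) (s := fun _ => s) (K := K)
    (Eventually.of_forall fun _ => hK) (hflow v hv (by rwa [hpos, hvel])) (hflow w hw hs)
    (by simp only [hpos, hvel])
  filter_upwards [hphase] with x hx
  exact congrArg Prod.fst hx

/-- While the velocity is positive, conservation of energy reads `w' = √(2 (e - U(w)))`. The
right-hand side is Lipschitz even where `f` is not. -/
lemma eventuallyEq_of_deriv_pos (hf : Continuous f) (hv : IsNewtonSolution f v)
    (hw : IsNewtonSolution f w) {t : ℝ} (hpos : v t = w t) (hvel : deriv v t = deriv w t)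
    (hne : 0 < deriv w t) : v =ᶠ[𝓝 t] w := by
  let U : ℝ → ℝ := fun x => -∫ y in (0)..x, f y
  have hU (x : ℝ) : HasDerivAt U (-f x) x := (hf.integral_hasStrictDerivAt 0 x).hasDerivAt.neg
  have hUc : ContDiff ℝ 1 U := contDiff_one_iff_deriv.2
    ⟨fun x => (hU x).differentiableAt, by rw [funext fun x => (hU x).deriv]; exact hf.neg⟩
  let e := energy U (w t) (deriv w t)
  let F : ℝ → ℝ := fun x => √(2 * (e - U x))
  have hF : ContDiffAt ℝ 1 F (w t) := by
    refine ContDiffAt.sqrt (contDiffAt_const.mul (contDiffAt_const.sub hUc.contDiffAt)) ?_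
    have : 0 < deriv w t ^ 2 := by positivity
    simp only [e, energy]
    linarith
  obtain ⟨K, s, hs, hK⟩ := hF.exists_lipschitzOnWith
  have hflow (u : ℝ → ℝ) (hu : IsNewtonSolution f u) (hs : s ∈ 𝓝 (u t))
      (hupos : 0 < deriv u t) (hen : energy U (u t) (deriv u t) = e) :
      ∀ᶠ x in 𝓝 t, HasDerivAt u (F (u x)) x ∧ u x ∈ s := by
    filter_upwards [hu.continuous.continuousAt hs,
      hu.continuous_deriv.continuousAt.eventually (lt_mem_nhds hupos)] with x hx hxpos
    refine ⟨(hu.hasDerivAt x).congr_deriv ?_, hx⟩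
    simp only [F]
    rw [← hen, hu.energy_eq hU t x, energy, eq_comm, Real.sqrt_eq_iff_mul_self_eq_of_pos hxpos]
    ring
  exact ODE_solution_unique_of_eventually (v := fun _ => F) (s := fun _ => s) (K := K)
    (Eventually.of_forall fun _ => hK)
    (hflow v hv (by rwa [hpos]) (by rwa [hvel]) (by rw [hpos, hvel])) (hflow w hw hs hne rfl) hpos

lemma eventuallyEq_of_deriv_ne_zero (hf : Continuous f) (hv : IsNewtonSolution f v)
    (hw : IsNewtonSolution f w) {t : ℝ} (hpos : v t = w t) (hvel : deriv v t = deriv w t)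
    (hne : deriv w t ≠ 0) : v =ᶠ[𝓝 t] w := by
  rcases hne.lt_or_gt with hneg | hpos'
  · have hrev : (fun s => v (-s)) =ᶠ[𝓝 (-t)] fun s => w (-s) :=
      eventuallyEq_of_deriv_pos hf hv.comp_neg hw.comp_neg (by simpa only [neg_neg])
        (by simp only [deriv_comp_neg, neg_neg, hvel])
        (by simpa only [deriv_comp_neg, neg_neg, neg_pos])
    filter_upwards [(continuous_neg.tendsto t).eventually hrev] with x hx
    simpa only [neg_neg] using hx
  · exact eventuallyEq_of_deriv_pos hf hv hw hpos hvel hpos'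

/-- Two solutions through the same point of the phase plane agree for as long as the orbit meets no
rest point at which `f` fails to be smooth. -/
theorem eqOn_of_isPreconnected (hf : Continuous f) (hv : IsNewtonSolution f v)
    (hw : IsNewtonSolution f w) {s : Set ℝ} (hs : IsPreconnected s)
    (hreg : ∀ t ∈ s, ContDiffAt ℝ 1 f (w t) ∨ deriv w t ≠ 0) {t₀ : ℝ} (ht₀ : t₀ ∈ s)
    (hpos : v t₀ = w t₀) (hvel : deriv v t₀ = deriv w t₀) : EqOn v w s := by
  let Z : Set ℝ := {t | v t = w t ∧ deriv v t = deriv w t}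
  have hclosed : IsClosed Z := (isClosed_eq hv.continuous hw.continuous).inter
    (isClosed_eq hv.continuous_deriv hw.continuous_deriv)
  have hloc : ∀ t ∈ s, t ∈ Z → t ∈ interior Z := by
    rintro t hts ⟨htpos, htvel⟩
    have hnear : v =ᶠ[𝓝 t] w := (hreg t hts).elim
      (fun hsmooth => eventuallyEq_of_contDiffAt hv hw hsmooth htpos htvel)
      (eventuallyEq_of_deriv_ne_zero hf hv hw htpos htvel)
    rw [mem_interior_iff_mem_nhds]
    filter_upwards [hnear, hnear.deriv] with x hx hx' using ⟨hx, hx'⟩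
  have hsub : s ⊆ interior Z :=
    hs.subset_of_closure_inter_subset isOpen_interior ⟨t₀, ht₀, hloc t₀ ht₀ ⟨hpos, hvel⟩⟩
      fun t ht => hloc t ht.2 (hclosed.closure_subset_iff.2 interior_subset ht.1)
  exact fun t ht => (interior_subset (hsub ht)).1

theorem isTimeShift_of_phase_eq (hf : Continuous f) (hv : IsNewtonSolution f v)
    (hw : IsNewtonSolution f w) (hreg : ∀ t, ContDiffAt ℝ 1 f (w t) ∨ deriv w t ≠ 0) {s t : ℝ}
    (hphase : (v s, deriv v s) = (w t, deriv w t)) : IsTimeShift v w := by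
  obtain ⟨hpos, hvel⟩ := Prod.mk.inj hphase
  have heq := eqOn_of_isPreconnected hf hv (hw.comp_add_const (t - s)) isPreconnected_univ
    (fun x _ => by simpa only [deriv_comp_add_const] using hreg (x + (t - s))) (mem_univ s)
    (by simpa only [add_sub_cancel]) (by simpa only [deriv_comp_add_const, add_sub_cancel])
  exact ⟨t - s, fun x => heq (mem_univ x)⟩

end IsNewtonSolution

section Rotation

open Set Filter Topology MeasureTheory Real

/-- The time change `t = ∫ g` turns a positive periodic function `g` into the inverse speed of a
rotation. -/
lemma exists_rotation {g : ℝ → ℝ} {T : ℝ} (hT : 0 < T) (hg : Continuous g) (hpos : ∀ x, 0 < g x)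
    (hper : Function.Periodic g T) :
    ∃ θ : ℝ → ℝ, (∀ t, HasDerivAt θ (g (θ t))⁻¹ t) ∧ StrictMono θ ∧ Function.Surjective θ ∧
      ∀ t, θ (t + ∫ x in (0)..T, g x) = θ t + T := by
  let τ : ℝ → ℝ := fun s => ∫ x in (0)..s, g x
  have hint (a b : ℝ) : IntervalIntegrable g volume a b := hg.intervalIntegrable a b
  have hτ (s : ℝ) : HasDerivAt τ (g s) s := (hg.integral_hasStrictDerivAt 0 s).hasDerivAt
  have hmono : StrictMono τ := strictMono_of_hasDerivAt_pos hτ hpos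
  have hcont : Continuous τ := continuous_iff_continuousAt.2 fun s => (hτ s).continuousAt
  have hτT : 0 < τ T :=
    intervalIntegral.intervalIntegral_pos_of_pos_on (hint _ _) (fun x _ => hpos x) hT
  have hsurj : Function.Surjective τ := hcont.surjective
    (hper.tendsto_atTop_intervalIntegral_of_pos hτT hT)
    (hper.tendsto_atBot_intervalIntegral_of_pos hτT hT)
  have hadd (s : ℝ) : τ (s + T) = τ s + τ T := by
    simp only [τ]
    rw [← intervalIntegral.integral_add_adjacent_intervals (hint 0 s) (hint s _),
      hper.intervalIntegral_add_eq s 0, zero_add]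
  let e := hmono.orderIsoOfSurjective τ hsurj
  have he (s : ℝ) : e s = τ s := rfl
  refine ⟨e.symm, fun t => ?_, e.symm.strictMono, e.symm.surjective, fun t => e.injective ?_⟩
  · exact HasDerivAt.of_local_left_inverse e.symm.continuous.continuousAt (hτ _) (hpos _).ne'
      (Eventually.of_forall e.apply_symm_apply)
  · rw [e.apply_symm_apply, he, hadd, ← he, e.apply_symm_apply]

/-- A closed curve in the phase plane that is tangent to the vector field `(y, f(x))` is the orbit
of a solution. The tangency factor `g` is the time spent per unit of the curve parameter. -/
theorem IsNewtonSolution.exists_of_parametrization {f g Φ Ψ : ℝ → ℝ} {x₀ : ℝ}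
    (hg : Continuous g) (hpos : ∀ x, 0 < g x) (hper : Function.Periodic g (2 * π))
    (hΦ : ∀ x, HasDerivAt Φ (Ψ x * g x) x) (hΨ : ∀ x, HasDerivAt Ψ (f (Φ x) * g x) x)
    (hΦper : Function.Periodic Φ (2 * π))
    (hsimple : ∀ x, Φ x = Φ x₀ → ∃ n : ℤ, x = x₀ + n * (2 * π)) :
    ∃ w : ℝ → ℝ, IsNewtonSolution f w ∧ phaseOrbit w = range (fun x => (Φ x, Ψ x)) ∧
      HasLeastPeriod w (∫ x in (0)..(2 * π), g x) := by
  obtain ⟨θ, hθ, hmono, hsurj, hadd⟩ := exists_rotation two_pi_pos hg hpos hper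
  have hT : 0 < ∫ x in (0)..(2 * π), g x := intervalIntegral.intervalIntegral_pos_of_pos_on
    (hg.intervalIntegrable _ _) (fun x _ => hpos x) two_pi_pos
  have hchain {F G : ℝ → ℝ} (hF : ∀ x, HasDerivAt F (G x * g x) x) (t : ℝ) :
      HasDerivAt (fun t => F (θ t)) (G (θ t)) t :=
    ((hF (θ t)).comp t (hθ t)).congr_deriv (mul_inv_cancel_right₀ (hpos _).ne' _)
  refine ⟨fun t => Φ (θ t), .of_hasDerivAt (hchain hΦ) (hchain hΨ), ?_,
    ⟨hT, fun t => ?_⟩, fun S ⟨hS, hSper⟩ => ?_⟩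
  · rw [phaseOrbit, funext fun t => (hchain hΦ t).deriv]
    exact hsurj.range_comp fun x => (Φ x, Ψ x)
  · simp only [hadd, hΦper (θ t)]
  · obtain ⟨t, rfl⟩ := hsurj x₀
    obtain ⟨n, hn⟩ := hsimple (θ (t + S)) (hSper t)
    have hadvance : 0 < n * (2 * π) := by linarith [hmono (lt_add_of_pos_right t hS)]
    have hn0 : (0 : ℝ) < n := pos_of_mul_pos_left hadvance two_pi_pos.le
    have hn1 : (1 : ℝ) ≤ n := mod_cast Int.add_one_le_of_lt (Int.cast_pos.1 hn0)
    have hle : θ (t + ∫ x in (0)..(2 * π), g x) ≤ θ (t + S) := by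
      rw [hadd, hn]
      nlinarith [two_pi_pos]
    exact le_of_add_le_add_left (hmono.le_iff_le.1 hle)

lemma intervalIntegral_two_pi_of_symm {g : ℝ → ℝ} (hg : Continuous g)
    (hper : Function.Periodic g (2 * π)) (hsymm : ∀ x, g (π - x) = g x) :
    ∫ x in (0)..(2 * π), g x = 2 * ∫ x in (0)..(π / 2), (g x + g (-x)) := by
  have hint (a b : ℝ) : IntervalIntegrable g volume a b := hg.intervalIntegrable a b
  have hshift : ∫ x in (0)..(2 * π), g x = ∫ x in (-(π / 2))..(-(π / 2) + 2 * π), g x := by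
    rw [hper.intervalIntegral_add_eq _ 0, zero_add]
  have hreflect : ∫ x in (π / 2)..(-(π / 2) + 2 * π), g x = ∫ x in (-(π / 2))..(π / 2), g x := by
    have := intervalIntegral.integral_comp_sub_left (a := -(π / 2)) (b := π / 2) g π
    simp only [hsymm] at this
    rw [this]
    congr 1 <;> ring
  have hneg : ∫ x in (-(π / 2))..0, g x = ∫ x in (0)..(π / 2), g (-x) := by
    rw [intervalIntegral.integral_comp_neg, neg_zero]
  rw [hshift, ← intervalIntegral.integral_add_adjacent_intervals (hint _ (π / 2)) (hint _ _),
    hreflect, ← intervalIntegral.integral_add_adjacent_intervals (hint _ 0) (hint 0 _), hneg,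
    intervalIntegral.integral_add (hint _ _) (Continuous.intervalIntegrable (by fun_prop) _ _)]
  ring

lemma sin_mem_Ioo {x : ℝ} (hx : x ∈ Ioo 0 (π / 2)) : sin x ∈ Ioo (0 : ℝ) 1 := by
  refine ⟨sin_pos_of_mem_Ioo ⟨hx.1, by linarith [hx.2, pi_pos]⟩, ?_⟩
  rw [← sin_pi_div_two]
  exact sin_lt_sin_of_lt_of_le_pi_div_two (by linarith [hx.1, pi_pos]) le_rfl hx.2

lemma exists_polar {y z r : ℝ} (hr : 0 ≤ r) (h : y ^ 2 + z ^ 2 = r ^ 2) :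
    ∃ x, r * sin x = y ∧ r * cos x = z := by
  have hnorm : ‖(⟨z, y⟩ : ℂ)‖ = r := by
    rw [Complex.norm_eq_sqrt_sq_add_sq, add_comm, h, sqrt_sq hr]
  refine ⟨Complex.arg ⟨z, y⟩, ?_, ?_⟩
  · rw [← hnorm, Complex.norm_mul_sin_arg]
  · rw [← hnorm, Complex.norm_mul_cos_arg]

lemma mul_sin_mem_Ico {r R x : ℝ} (hr : r ∈ Icc 0 R) (hR : 0 < R) (hx : x ∈ Ioo 0 (π / 2)) :
    r * sin x ∈ Ico 0 R := by
  obtain ⟨h0, h1⟩ := sin_mem_Ioo hx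
  exact ⟨mul_nonneg hr.1 h0.le, by nlinarith [hr.2]⟩

end Rotation

section ParametricIntegral

open Set Filter Topology MeasureTheory

variable {p : ℝ → ℝ → ℝ} {a b α β : ℝ}

lemma norm_le_of_monotoneOn_param (hnn : ∀ x ∈ Ioo α β, 0 ≤ p a x)
    (hmono : ∀ x ∈ Ioo α β, MonotoneOn (fun c => p c x) (Icc a b)) {c : ℝ} (hc : c ∈ Icc a b) :
    ∀ᵐ x ∂volume.restrict (Ioo α β), ‖p c x‖ ≤ p b x := by
  have hab : a ≤ b := hc.1.trans hc.2
  refine (ae_restrict_iff' measurableSet_Ioo).2 (Eventually.of_forall fun x hx => ?_)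
  rw [Real.norm_of_nonneg ((hnn x hx).trans (hmono x hx (left_mem_Icc.2 hab) hc hc.1))]
  exact hmono x hx hc (right_mem_Icc.2 hab) hc.2

theorem continuousOn_intervalIntegral_of_monotoneOn_param (hαβ : α ≤ β)
    (hmono : ∀ x ∈ Ioo α β, MonotoneOn (fun c => p c x) (Icc a b))
    (hcont : ∀ x ∈ Ioo α β, ContinuousOn (fun c => p c x) (Icc a b))
    (hmeas : ∀ c ∈ Icc a b, ContinuousOn (p c) (Ioo α β))
    (hnn : ∀ x ∈ Ioo α β, 0 ≤ p a x) (hint : IntervalIntegrable (p b) volume α β) :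
    ContinuousOn (fun c => ∫ x in α..β, p c x) (Icc a b) := by
  simp only [intervalIntegral.integral_of_le hαβ, integral_Ioc_eq_integral_Ioo]
  intro c hc
  refine continuousWithinAt_of_dominated (bound := p b) ?_ ?_
    ((intervalIntegrable_iff_integrableOn_Ioo_of_le hαβ).1 hint) ?_
  · filter_upwards [self_mem_nhdsWithin] with d hd
      using (hmeas d hd).aestronglyMeasurable measurableSet_Ioo
  · filter_upwards [self_mem_nhdsWithin] with d hd using norm_le_of_monotoneOn_param hnn hmono hd
  · exact (ae_restrict_iff' measurableSet_Ioo).2 (Eventually.of_forall fun x hx => hcont x hx c hc)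

theorem strictMonoOn_intervalIntegral_of_strictMonoOn_param (hαβ : α < β)
    (hmono : ∀ x ∈ Ioo α β, StrictMonoOn (fun c => p c x) (Icc a b))
    (hmeas : ∀ c ∈ Icc a b, ContinuousOn (p c) (Ioo α β))
    (hnn : ∀ x ∈ Ioo α β, 0 ≤ p a x) (hint : IntervalIntegrable (p b) volume α β) :
    StrictMonoOn (fun c => ∫ x in α..β, p c x) (Icc a b) := by
  rw [intervalIntegrable_iff_integrableOn_Ioo_of_le hαβ.le] at hint
  have hint' (c : ℝ) (hc : c ∈ Icc a b) : IntervalIntegrable (p c) volume α β :=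
    (intervalIntegrable_iff_integrableOn_Ioo_of_le hαβ.le).2 <|
      Integrable.mono' hint ((hmeas c hc).aestronglyMeasurable measurableSet_Ioo)
        (norm_le_of_monotoneOn_param hnn (fun x hx => (hmono x hx).monotoneOn) hc)
  intro c hc d hd hcd
  have hdiff := intervalIntegral.intervalIntegral_pos_of_pos_on ((hint' d hd).sub (hint' c hc))
    (fun x hx => sub_pos.2 (hmono x hx hc hd hcd)) hαβ
  rwa [intervalIntegral.integral_sub (hint' d hd) (hint' c hc), sub_pos] at hdiff

lemma integrable_and_integral_eq_sub_of_deriv_nonneg {F f : ℝ → ℝ} (hαβ : α ≤ β)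
    (hF : ContinuousOn F (Icc α β)) (hd : ∀ x ∈ Ioo α β, HasDerivAt F (f x) x)
    (hnn : ∀ x ∈ Ioo α β, 0 ≤ f x) :
    IntervalIntegrable f volume α β ∧ ∫ x in α..β, f x = F β - F α := by
  have hint : IntervalIntegrable f volume α β := by
    apply intervalIntegral.intervalIntegrable_deriv_of_nonneg (g := F) <;>
      simpa only [uIcc_of_le hαβ, min_eq_left hαβ, max_eq_right hαβ]
  exact ⟨hint, intervalIntegral.integral_eq_sub_of_hasDerivAt_of_le hαβ hF hd hint⟩

end ParametricIntegral

section PeriodFamily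

open Set

/-- If the solutions of a class form, up to time shifts, a one-parameter family whose least period
increases strictly and continuously with the parameter, then every intermediate period is attained
exactly once. -/
theorem existsUnique_of_strictMonoOn_period {P : ℝ → ℝ} {a b T : ℝ} (hab : a ≤ b)
    (hmono : StrictMonoOn P (Icc a b)) (hcont : ContinuousOn P (Icc a b))
    {C : (ℝ → ℝ) → Prop} {W : ℝ → ℝ → ℝ}
    (hW : ∀ c ∈ Ioo a b, C (W c) ∧ HasLeastPeriod (W c) (P c)) (hT : T ∈ Ioo (P a) (P b))
    (hall : ∀ v, C v → HasLeastPeriod v T → ∃ c ∈ Ioo a b, IsTimeShift v (W c)) :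
    ∃ w, (C w ∧ HasLeastPeriod w T) ∧ ∀ v, C v → HasLeastPeriod v T → IsTimeShift v w := by
  obtain ⟨c, hc, rfl⟩ := intermediate_value_Ioo hab hcont hT
  refine ⟨W c, hW c hc, fun v hv hvT => ?_⟩
  obtain ⟨d, hd, hvd⟩ := hall v hv hvT
  have hPdc : P d = P c := ((hvd.hasLeastPeriod (hW d hd).2).unique hvT :)
  rwa [← hmono.injOn (Ioo_subset_Icc_self hd) (Ioo_subset_Icc_self hc) hPdc]

end PeriodFamily

section RemovableSingularity

open Filter Topology

lemma hasDerivAt_mul_of_eq_zero {u v : ℝ → ℝ} {u' x : ℝ} (hu : HasDerivAt u u' x) (h0 : u x = 0)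
    (hv : ContinuousAt v x) : HasDerivAt (fun y => u y * v y) (u' * v x) x := by
  rw [hasDerivAt_iff_tendsto_slope] at hu ⊢
  refine (hu.mul (hv.tendsto.mono_left nhdsWithin_le_nhds)).congr fun y => ?_
  simp only [slope_def_field, h0]
  ring

lemma hasDerivAt_of_hasDerivAt_sq {u : ℝ → ℝ} {d x : ℝ} (hu : ContinuousAt u x) (h0 : u x ≠ 0)
    (hsq : HasDerivAt (fun y => u y ^ 2) d x) : HasDerivAt u (d / (2 * u x)) x := by
  have hsum : ContinuousAt (fun y => u y + u x) x := hu.add_const (u x)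
  have hne : u x + u x ≠ 0 := by rwa [← two_mul, mul_ne_zero_iff_left two_ne_zero]
  rw [hasDerivAt_iff_tendsto_slope] at hsq ⊢
  rw [two_mul]
  refine (hsq.div (hsum.tendsto.mono_left nhdsWithin_le_nhds) hne).congr' ?_
  filter_upwards [(hsum.eventually_ne hne).filter_mono nhdsWithin_le_nhds] with y hy
  rw [Pi.div_apply, slope_def_field, slope_def_field]
  field_simp
  ring

end RemovableSingularity

section PotentialWell

open Set Filter Topology Real

/-- A potential well on `[a, ∞)`: the potential `U` decreases up to the nondegenerate bottom `b` and
then increases to infinity. The force is `f = -U'`, and `κ` is the curvature of `U` at `b`. -/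
structure IsPotentialWell (U f : ℝ → ℝ) (a b κ : ℝ) : Prop where
  lt : a < b
  curvature_pos : 0 < κ
  continuousOn : ContinuousOn U (Ici a)
  hasDerivAt {x : ℝ} (hx : a < x) : HasDerivAt U (-f x) x
  continuousOn_force : ContinuousOn f (Ioi a)
  force_pos {x : ℝ} (hx : x ∈ Ioo a b) : 0 < f x
  force_neg {x : ℝ} (hx : b < x) : f x < 0
  hasDerivAt_force : HasDerivAt f (-κ) b
  tendsto : Tendsto U atTop atTop

/-- The signed square root of `2 (U - U b)`, written so that its differentiability at the bottom `b`
is that of a product. -/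
noncomputable def wellRoot (U : ℝ → ℝ) (b x : ℝ) : ℝ := (x - b) * √(2 * (U x - U b) / (x - b) ^ 2)

/-- The coordinate that turns the well `U` on `[a, ∞)` into the parabola `y² / 2`, extended to the
real line as an increasing bijection. -/
noncomputable def wellCoord (U : ℝ → ℝ) (a b x : ℝ) : ℝ := min (x - a) 0 + wellRoot U b (max x a)

/-- The inverse of `wellCoord`. -/
noncomputable def wellInv (U : ℝ → ℝ) (a b : ℝ) : ℝ → ℝ := Function.invFun (wellCoord U a b)

/-- The depth `U a - U b` of the well, measured in the coordinate `wellCoord`. -/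
noncomputable def wellRadius (U : ℝ → ℝ) (a b : ℝ) : ℝ := √(2 * (U a - U b))

/-- The time that the motion in the well with `energy U b + r² / 2` takes from its minimum to its
maximum. -/
noncomputable def wellHalfPeriod (U : ℝ → ℝ) (a b r : ℝ) : ℝ :=
  ∫ x in (0)..(π / 2), (deriv (wellInv U a b) (r * sin x) + deriv (wellInv U a b) (-(r * sin x)))

lemma wellCoord_of_le {U : ℝ → ℝ} {a b x : ℝ} (hx : a ≤ x) :
    wellCoord U a b x = wellRoot U b x := by
  rw [wellCoord, min_eq_right (sub_nonneg.2 hx), max_eq_left hx, zero_add]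

lemma wellRoot_self (U : ℝ → ℝ) (b : ℝ) : wellRoot U b b = 0 := by
  rw [wellRoot, sub_self, zero_mul]

namespace IsPotentialWell

variable {U f : ℝ → ℝ} {a b κ : ℝ}

lemma potential_lt (hU : IsPotentialWell U f a b κ) {x : ℝ} (hx : a ≤ x) (hne : x ≠ b) :
    U b < U x := by
  rcases hne.lt_or_gt with h | h
  · refine strictAntiOn_of_deriv_neg (convex_Icc a b) (hU.continuousOn.mono Icc_subset_Ici_self)
      (fun y hy => ?_) ⟨hx, h.le⟩ (right_mem_Icc.2 hU.lt.le) h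
    rw [interior_Icc] at hy
    rw [(hU.hasDerivAt hy.1).deriv]
    exact neg_neg_of_pos (hU.force_pos hy)
  · refine strictMonoOn_of_deriv_pos (convex_Ici b)
      (hU.continuousOn.mono (Ici_subset_Ici.2 hU.lt.le)) (fun y hy => ?_) self_mem_Ici h.le h
    rw [interior_Ici] at hy
    rw [(hU.hasDerivAt (hU.lt.trans hy)).deriv]
    exact neg_pos.2 (hU.force_neg hy)

lemma potential_le (hU : IsPotentialWell U f a b κ) {x : ℝ} (hx : a ≤ x) : U b ≤ U x := by
  rcases eq_or_ne x b with rfl | hne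
  · exact le_rfl
  · exact (hU.potential_lt hx hne).le

lemma force_bottom (hU : IsPotentialWell U f a b κ) : f b = 0 := by
  have hmin : IsLocalMin U b := by
    filter_upwards [lt_mem_nhds hU.lt] with x hx using hU.potential_le hx.le
  exact neg_eq_zero.1 (hmin.hasDerivAt_eq_zero (hU.hasDerivAt hU.lt))

lemma force_ne_zero (hU : IsPotentialWell U f a b κ) {x : ℝ} (hx : a < x) (hne : x ≠ b) :
    f x ≠ 0 := by
  rcases hne.lt_or_gt with h | h
  · exact (hU.force_pos ⟨hx, h⟩).ne'
  · exact (hU.force_neg h).ne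

lemma wellRoot_sq (hU : IsPotentialWell U f a b κ) {x : ℝ} (hx : a ≤ x) :
    wellRoot U b x ^ 2 = 2 * (U x - U b) := by
  rcases eq_or_ne x b with rfl | hne
  · rw [wellRoot_self, sub_self, mul_zero, sq, mul_zero]
  · have hE : 0 < U x - U b := sub_pos.2 (hU.potential_lt hx hne)
    rw [wellRoot, mul_pow, sq_sqrt (by positivity),
      mul_div_cancel₀ _ (pow_ne_zero 2 (sub_ne_zero.2 hne))]

lemma wellRoot_pos (hU : IsPotentialWell U f a b κ) {x : ℝ} (hx : b < x) : 0 < wellRoot U b x := by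
  have hE : 0 < U x - U b := sub_pos.2 (hU.potential_lt (hU.lt.trans hx).le hx.ne')
  exact mul_pos (sub_pos.2 hx) (sqrt_pos.2
    (div_pos (mul_pos two_pos hE) (sq_pos_of_ne_zero (sub_ne_zero.2 hx.ne'))))

lemma wellRoot_neg (hU : IsPotentialWell U f a b κ) {x : ℝ} (hax : a ≤ x) (hxb : x < b) :
    wellRoot U b x < 0 := by
  have hE : 0 < U x - U b := sub_pos.2 (hU.potential_lt hax hxb.ne)
  exact mul_neg_of_neg_of_pos (sub_neg.2 hxb) (sqrt_pos.2
    (div_pos (mul_pos two_pos hE) (sq_pos_of_ne_zero (sub_ne_zero.2 hxb.ne))))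

lemma tendsto_neg_force_div (hU : IsPotentialWell U f a b κ) :
    Tendsto (fun x => -f x / (x - b)) (𝓝[≠] b) (𝓝 κ) := by
  have h := hU.hasDerivAt_force.neg
  rw [neg_neg, hasDerivAt_iff_tendsto_slope] at h
  refine h.congr fun x => ?_
  simp only [slope_def_field, Pi.neg_apply, hU.force_bottom, neg_zero, sub_zero]

lemma tendsto_two_mul_potential_div_sq (hU : IsPotentialWell U f a b κ) :
    Tendsto (fun x => 2 * (U x - U b) / (x - b) ^ 2) (𝓝[≠] b) (𝓝 κ) := by
  have hmem : ∀ᶠ x in 𝓝[≠] b, a < x := (lt_mem_nhds hU.lt).filter_mono nhdsWithin_le_nhds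
  refine HasDerivAt.lhopital_zero_nhdsNE (f' := fun x => 2 * -f x) (g' := fun x => 2 * (x - b))
    ?_ ?_ ?_ ?_ ?_ ?_
  · filter_upwards [hmem] with x hx using ((hU.hasDerivAt hx).sub_const _).const_mul 2
  · exact Eventually.of_forall fun x => by simpa using ((hasDerivAt_id x).sub_const b).fun_pow 2
  · filter_upwards [self_mem_nhdsWithin] with x hx
      using mul_ne_zero two_ne_zero (sub_ne_zero.2 hx)
  · have hcont : ContinuousAt (fun x => 2 * (U x - U b)) b :=
      ((hU.hasDerivAt hU.lt).continuousAt.sub_const (U b)).const_mul 2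
    simpa using hcont.tendsto.mono_left nhdsWithin_le_nhds
  · exact (Continuous.tendsto' (by fun_prop) _ _ (by simp)).mono_left nhdsWithin_le_nhds
  · exact hU.tendsto_neg_force_div.congr fun x => (mul_div_mul_left _ _ two_ne_zero).symm

lemma hasDerivAt_wellRoot_bottom (hU : IsPotentialWell U f a b κ) :
    HasDerivAt (wellRoot U b) (√κ) b := by
  rw [hasDerivAt_iff_tendsto_slope]
  refine hU.tendsto_two_mul_potential_div_sq.sqrt.congr' ?_
  filter_upwards [self_mem_nhdsWithin] with x hx
  rw [slope_def_field, wellRoot_self, sub_zero, wellRoot, mul_div_cancel_left₀ _ (sub_ne_zero.2 hx)]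

lemma hasDerivAt_wellRoot (hU : IsPotentialWell U f a b κ) {x : ℝ} (hx : a < x) (hne : x ≠ b) :
    HasDerivAt (wellRoot U b) (-f x / wellRoot U b x) x := by
  have hcont : ContinuousAt (wellRoot U b) x :=
    (continuousAt_id.sub_const b).mul (((((hU.hasDerivAt hx).continuousAt.sub_const (U b)).const_mul
      2).div ((continuousAt_id.sub_const b).pow 2) (pow_ne_zero 2 (sub_ne_zero.2 hne))).sqrt)
  have h0 : wellRoot U b x ≠ 0 := by
    rcases hne.lt_or_gt with h | h
    · exact (hU.wellRoot_neg hx.le h).ne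
    · exact (hU.wellRoot_pos h).ne'
  have hsq : HasDerivAt (fun y => wellRoot U b y ^ 2) (2 * -f x) x :=
    (((hU.hasDerivAt hx).sub_const (U b)).const_mul 2).congr_of_eventuallyEq (by
      filter_upwards [lt_mem_nhds hx] with y hy using hU.wellRoot_sq hy.le)
  exact (hasDerivAt_of_hasDerivAt_sq hcont h0 hsq).congr_deriv (mul_div_mul_left _ _ two_ne_zero)

lemma continuousOn_wellRoot (hU : IsPotentialWell U f a b κ) :
    ContinuousOn (wellRoot U b) (Ici a) := by
  intro x hx
  rcases eq_or_ne x b with rfl | hne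
  · exact hU.hasDerivAt_wellRoot_bottom.continuousAt.continuousWithinAt
  · have hcont := hU.continuousOn x hx
    exact (continuousWithinAt_id.sub continuousWithinAt_const).mul
      ((((hcont.sub continuousWithinAt_const).const_mul 2).div
        ((continuousWithinAt_id.sub continuousWithinAt_const).pow 2)
        (pow_ne_zero 2 (sub_ne_zero.2 hne))).sqrt)

lemma strictMonoOn_wellRoot (hU : IsPotentialWell U f a b κ) :
    StrictMonoOn (wellRoot U b) (Ici a) := by
  refine strictMonoOn_of_deriv_pos (convex_Ici a) hU.continuousOn_wellRoot fun x hx => ?_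
  rw [interior_Ici] at hx
  rcases lt_trichotomy x b with h | rfl | h
  · rw [(hU.hasDerivAt_wellRoot hx h.ne).deriv]
    exact div_pos_of_neg_of_neg (neg_neg_of_pos (hU.force_pos ⟨hx, h⟩)) (hU.wellRoot_neg hx.le h)
  · rw [hU.hasDerivAt_wellRoot_bottom.deriv]
    exact sqrt_pos.2 hU.curvature_pos
  · rw [(hU.hasDerivAt_wellRoot hx h.ne').deriv]
    exact div_pos (neg_pos.2 (hU.force_neg h)) (hU.wellRoot_pos h)

lemma continuous_wellCoord (hU : IsPotentialWell U f a b κ) : Continuous (wellCoord U a b) := by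
  have hmax : Continuous fun x => wellRoot U b (max x a) :=
    hU.continuousOn_wellRoot.comp_continuous (by fun_prop) fun x => le_max_right x a
  unfold wellCoord
  fun_prop

lemma strictMono_wellCoord (hU : IsPotentialWell U f a b κ) : StrictMono (wellCoord U a b) := by
  intro x y hxy
  rcases lt_or_ge x a with hx | hx
  · refine add_lt_add_of_lt_of_le ?_ (hU.strictMonoOn_wellRoot.monotoneOn (le_max_right x a)
      (le_max_right y a) (max_le_max_right a hxy.le))
    rw [min_eq_left (sub_nonpos.2 hx.le)]
    exact lt_min (sub_lt_sub_right hxy a) (sub_neg.2 hx)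
  · rw [wellCoord_of_le hx, wellCoord_of_le (hx.trans hxy.le)]
    exact hU.strictMonoOn_wellRoot hx (hx.trans hxy.le) hxy

lemma surjective_wellCoord (hU : IsPotentialWell U f a b κ) :
    Function.Surjective (wellCoord U a b) := by
  refine hU.continuous_wellCoord.surjective ?_ ?_
  · have hroot : Tendsto (fun x => √(2 * (U x + -U b))) atTop atTop :=
      tendsto_sqrt_atTop.comp
        ((tendsto_atTop_add_const_right _ _ hU.tendsto).const_mul_atTop two_pos)
    refine hroot.congr' ?_
    filter_upwards [eventually_gt_atTop b] with x hx
    have hax := (hU.lt.trans hx).le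
    rw [wellCoord_of_le hax, ← sub_eq_add_neg, ← hU.wellRoot_sq hax,
      sqrt_sq (hU.wellRoot_pos hx).le]
  · refine (tendsto_atBot_add_const_right _ (-a + wellRoot U b a) tendsto_id).congr' ?_
    filter_upwards [eventually_le_atBot a] with x hx
    rw [wellCoord, min_eq_left (sub_nonpos.2 hx), max_eq_right hx, id, ← add_assoc, sub_eq_add_neg]

lemma wellInv_wellCoord (hU : IsPotentialWell U f a b κ) (x : ℝ) :
    wellInv U a b (wellCoord U a b x) = x :=
  Function.leftInverse_invFun hU.strictMono_wellCoord.injective x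

lemma wellCoord_wellInv (hU : IsPotentialWell U f a b κ) (y : ℝ) :
    wellCoord U a b (wellInv U a b y) = y :=
  Function.rightInverse_invFun hU.surjective_wellCoord y

lemma strictMono_wellInv (hU : IsPotentialWell U f a b κ) : StrictMono (wellInv U a b) :=
  fun x y hxy => by
    rwa [← hU.strictMono_wellCoord.lt_iff_lt, hU.wellCoord_wellInv, hU.wellCoord_wellInv]

lemma continuous_wellInv (hU : IsPotentialWell U f a b κ) : Continuous (wellInv U a b) :=
  hU.strictMono_wellInv.monotone.continuous_of_surjective
    fun x => ⟨wellCoord U a b x, hU.wellInv_wellCoord x⟩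

lemma wellRadius_sq (hU : IsPotentialWell U f a b κ) : wellRadius U a b ^ 2 = 2 * (U a - U b) :=
  sq_sqrt (mul_nonneg zero_le_two (sub_nonneg.2 (hU.potential_le le_rfl)))

lemma wellRadius_pos (hU : IsPotentialWell U f a b κ) : 0 < wellRadius U a b :=
  sqrt_pos.2 (mul_pos two_pos (sub_pos.2 (hU.potential_lt le_rfl hU.lt.ne)))

lemma wellInv_neg_wellRadius (hU : IsPotentialWell U f a b κ) :
    wellInv U a b (-wellRadius U a b) = a := by
  have hroot : wellRoot U b a = -wellRadius U a b := by
    rw [← neg_eq_iff_eq_neg, wellRadius, ← hU.wellRoot_sq le_rfl, sqrt_sq_eq_abs,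
      abs_of_neg (hU.wellRoot_neg le_rfl hU.lt)]
  rw [← hroot, ← wellCoord_of_le le_rfl, hU.wellInv_wellCoord]

lemma wellInv_zero (hU : IsPotentialWell U f a b κ) : wellInv U a b 0 = b := by
  rw [← wellRoot_self U b, ← wellCoord_of_le hU.lt.le, hU.wellInv_wellCoord]

lemma wellInv_ne_bottom (hU : IsPotentialWell U f a b κ) {y : ℝ} (hy : y ≠ 0) :
    wellInv U a b y ≠ b := by
  have hne := hU.strictMono_wellInv.injective.ne hy
  rwa [hU.wellInv_zero] at hne

section InWell

variable {y : ℝ}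

lemma lt_wellInv (hU : IsPotentialWell U f a b κ) (hy : -wellRadius U a b < y) :
    a < wellInv U a b y := by
  have hlt := hU.strictMono_wellInv hy
  rwa [hU.wellInv_neg_wellRadius] at hlt

lemma wellRoot_wellInv (hU : IsPotentialWell U f a b κ) (hy : -wellRadius U a b < y) :
    wellRoot U b (wellInv U a b y) = y := by
  rw [← wellCoord_of_le (hU.lt_wellInv hy).le, hU.wellCoord_wellInv]

lemma two_mul_potential_wellInv (hU : IsPotentialWell U f a b κ) (hy : -wellRadius U a b < y) :
    2 * (U (wellInv U a b y) - U b) = y ^ 2 := by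
  rw [← hU.wellRoot_sq (hU.lt_wellInv hy).le, hU.wellRoot_wellInv hy]

lemma hasDerivAt_wellInv_of_hasDerivAt (hU : IsPotentialWell U f a b κ)
    (hy : -wellRadius U a b < y) {d : ℝ} (hd : HasDerivAt (wellRoot U b) d (wellInv U a b y))
    (hd0 : d ≠ 0) : HasDerivAt (wellInv U a b) d⁻¹ y := by
  refine HasDerivAt.of_local_left_inverse hU.continuous_wellInv.continuousAt
    (hd.congr_of_eventuallyEq ?_) hd0 (Eventually.of_forall hU.wellCoord_wellInv)
  filter_upwards [lt_mem_nhds (hU.lt_wellInv hy)] with x hx using wellCoord_of_le hx.le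

lemma hasDerivAt_wellInv_zero (hU : IsPotentialWell U f a b κ) :
    HasDerivAt (wellInv U a b) (√κ)⁻¹ 0 :=
  hU.hasDerivAt_wellInv_of_hasDerivAt (neg_neg_of_pos hU.wellRadius_pos)
    (hU.wellInv_zero.symm ▸ hU.hasDerivAt_wellRoot_bottom) (sqrt_pos.2 hU.curvature_pos).ne'

lemma hasDerivAt_wellInv_of_ne (hU : IsPotentialWell U f a b κ) (hy : -wellRadius U a b < y)
    (hy0 : y ≠ 0) : HasDerivAt (wellInv U a b) (y / -f (wellInv U a b y)) y := by
  have hne := hU.wellInv_ne_bottom hy0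
  have hlt := hU.lt_wellInv hy
  have hroot := hU.hasDerivAt_wellRoot hlt hne
  rw [hU.wellRoot_wellInv hy] at hroot
  exact (hU.hasDerivAt_wellInv_of_hasDerivAt hy hroot
    (div_ne_zero (neg_ne_zero.2 (hU.force_ne_zero hlt hne)) hy0)).congr_deriv (inv_div _ _)

lemma hasDerivAt_wellInv (hU : IsPotentialWell U f a b κ) (hy : -wellRadius U a b < y) :
    HasDerivAt (wellInv U a b) (deriv (wellInv U a b) y) y := by
  rcases eq_or_ne y 0 with rfl | hy0
  · exact hU.hasDerivAt_wellInv_zero.differentiableAt.hasDerivAt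
  · exact (hU.hasDerivAt_wellInv_of_ne hy hy0).differentiableAt.hasDerivAt

lemma force_mul_deriv_wellInv (hU : IsPotentialWell U f a b κ) (hy : -wellRadius U a b < y) :
    f (wellInv U a b y) * deriv (wellInv U a b) y = -y := by
  rcases eq_or_ne y 0 with rfl | hy0
  · rw [hU.wellInv_zero, hU.force_bottom, zero_mul, neg_zero]
  · rw [(hU.hasDerivAt_wellInv_of_ne hy hy0).deriv, div_neg, mul_neg, mul_div_cancel₀ _
      (hU.force_ne_zero (hU.lt_wellInv hy) (hU.wellInv_ne_bottom hy0))]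

lemma deriv_wellInv_pos (hU : IsPotentialWell U f a b κ) (hy : -wellRadius U a b < y) :
    0 < deriv (wellInv U a b) y := by
  rcases eq_or_ne y 0 with rfl | hy0
  · rw [hU.hasDerivAt_wellInv_zero.deriv]
    exact inv_pos.2 (sqrt_pos.2 hU.curvature_pos)
  · refine lt_of_le_of_ne hU.strictMono_wellInv.monotone.deriv_nonneg fun h => hy0 ?_
    rw [← neg_eq_zero, ← hU.force_mul_deriv_wellInv hy, ← h, mul_zero]

lemma continuousAt_deriv_wellInv (hU : IsPotentialWell U f a b κ) (hy : -wellRadius U a b < y) :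
    ContinuousAt (deriv (wellInv U a b)) y := by
  have hnhds : ∀ᶠ z in 𝓝 y, -wellRadius U a b < z := lt_mem_nhds hy
  rcases eq_or_ne y 0 with rfl | hy0
  · have hslope := hasDerivAt_iff_tendsto_slope.1 hU.hasDerivAt_wellRoot_bottom
    have hlim := hslope.div hU.tendsto_neg_force_div hU.curvature_pos.ne'
    have hinv : Tendsto (wellInv U a b) (𝓝[≠] 0) (𝓝[≠] b) := by
      refine tendsto_nhdsWithin_iff.2 ⟨?_, ?_⟩
      · exact (hU.continuous_wellInv.tendsto' 0 b hU.wellInv_zero).mono_left nhdsWithin_le_nhds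
      · filter_upwards [self_mem_nhdsWithin] with z hz using hU.wellInv_ne_bottom hz
    rw [continuousAt_iff_punctured_nhds, hU.hasDerivAt_wellInv_zero.deriv, ← sqrt_div_self]
    refine (hlim.comp hinv).congr' ?_
    filter_upwards [self_mem_nhdsWithin, hnhds.filter_mono nhdsWithin_le_nhds] with z hz0 hz
    rw [(hU.hasDerivAt_wellInv_of_ne hz hz0).deriv, Function.comp_apply, Pi.div_apply,
      slope_def_field, wellRoot_self, sub_zero, hU.wellRoot_wellInv hz,
      div_div_div_cancel_right₀ (sub_ne_zero.2 (hU.wellInv_ne_bottom hz0))]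
  · have hlt := hU.lt_wellInv hy
    have hforce : ContinuousAt f (wellInv U a b y) :=
      hU.continuousOn_force.continuousAt (Ioi_mem_nhds hlt)
    refine ((continuousAt_id.div (hforce.comp hU.continuous_wellInv.continuousAt).neg
      (neg_ne_zero.2 (hU.force_ne_zero hlt (hU.wellInv_ne_bottom hy0)))).congr ?_)
    filter_upwards [isOpen_ne.mem_nhds hy0, hnhds] with z hz0 hz
    exact (hU.hasDerivAt_wellInv_of_ne hz hz0).deriv.symm

end InWell

lemma wellHalfPeriod_zero (hU : IsPotentialWell U f a b κ) :
    wellHalfPeriod U a b 0 = π / √κ := by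
  simp only [wellHalfPeriod, zero_mul, neg_zero, hU.hasDerivAt_wellInv_zero.deriv,
    intervalIntegral.integral_const, smul_eq_mul]
  ring

lemma range_wellInv_sin_cos (hU : IsPotentialWell U f a b κ) {r : ℝ}
    (hr : r ∈ Ioo 0 (wellRadius U a b)) :
    range (fun x => (wellInv U a b (r * sin x), r * cos x))
      = {p | a < p.1 ∧ energy U p.1 p.2 = U b + r ^ 2 / 2} := by
  ext ⟨x, z⟩
  simp only [mem_range, Prod.mk.injEq, mem_ofPred_eq, energy]
  constructor
  · rintro ⟨θ, rfl, rfl⟩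
    have hθ : -wellRadius U a b < r * sin θ := by nlinarith [neg_one_le_sin θ, hr.1, hr.2]
    refine ⟨hU.lt_wellInv hθ, ?_⟩
    linear_combination (1 / 2) * hU.two_mul_potential_wellInv hθ
      + r ^ 2 / 2 * sin_sq_add_cos_sq θ
  · rintro ⟨hx, he⟩
    have hcircle : wellCoord U a b x ^ 2 + z ^ 2 = r ^ 2 := by
      rw [wellCoord_of_le hx.le, hU.wellRoot_sq hx.le]
      linear_combination 2 * he
    obtain ⟨θ, hsin, hcos⟩ := exists_polar hr.1.le hcircle
    exact ⟨θ, by rw [hsin, hU.wellInv_wellCoord], hcos⟩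

theorem exists_periodic (hU : IsPotentialWell U f a b κ) {r : ℝ}
    (hr : r ∈ Ioo 0 (wellRadius U a b)) :
    ∃ w : ℝ → ℝ, IsNewtonSolution f w ∧
      phaseOrbit w = {p | a < p.1 ∧ energy U p.1 p.2 = U b + r ^ 2 / 2} ∧
      HasLeastPeriod w (2 * wellHalfPeriod U a b r) := by
  have hlt (x : ℝ) : -wellRadius U a b < r * sin x := by nlinarith [neg_one_le_sin x, hr.1, hr.2]
  have hcont : Continuous fun x => deriv (wellInv U a b) (r * sin x) :=
    continuous_iff_continuousAt.2 fun x => (hU.continuousAt_deriv_wellInv (hlt x)).comp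
      (f := fun x => r * sin x) (by fun_prop)
  have hper : Function.Periodic (fun x => deriv (wellInv U a b) (r * sin x)) (2 * π) :=
    fun x => by simp only [sin_add_two_pi]
  have hsin (x : ℝ) : HasDerivAt (fun x => r * sin x) (r * cos x) x :=
    (hasDerivAt_sin x).const_mul r
  have hmax (x : ℝ) (hx : wellInv U a b (r * sin x) = wellInv U a b (r * sin (π / 2))) :
      ∃ n : ℤ, x = π / 2 + n * (2 * π) := by
    have hx1 := mul_left_cancel₀ hr.1.ne' (hU.strictMono_wellInv.injective hx)
    rw [sin_pi_div_two, sin_eq_one_iff] at hx1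
    exact hx1.imp fun n hn => hn.symm
  obtain ⟨w, hw, horbit, hleast⟩ := IsNewtonSolution.exists_of_parametrization (f := f)
    (Φ := fun x => wellInv U a b (r * sin x)) (Ψ := fun x => r * cos x) hcont
    (fun x => hU.deriv_wellInv_pos (hlt x)) hper
    (fun x => ((hU.hasDerivAt_wellInv (hlt x)).comp x (hsin x)).congr_deriv (mul_comm _ _))
    (fun x => ((hasDerivAt_cos x).const_mul r).congr_deriv (by
      rw [hU.force_mul_deriv_wellInv (hlt x), mul_neg]))
    (fun x => by simp only [sin_add_two_pi]) hmax
  rw [intervalIntegral_two_pi_of_symm hcont hper (fun x => by simp only [sin_pi_sub])] at hleast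
  simp only [sin_neg, mul_neg] at hleast
  exact ⟨w, hw, horbit.trans (hU.range_wellInv_sin_cos hr), hleast⟩

section HalfPeriod

lemma hasDerivAt_deriv_wellInv (hU : IsPotentialWell U f a b κ) {y d : ℝ}
    (hy : -wellRadius U a b < y) (hy0 : y ≠ 0) (hf : HasDerivAt f d (wellInv U a b y)) :
    HasDerivAt (deriv (wellInv U a b))
      ((f (wellInv U a b y) ^ 2 + 2 * (U (wellInv U a b y) - U b) * d)
        / (-f (wellInv U a b y)) ^ 3) y := by
  have hne := hU.force_ne_zero (hU.lt_wellInv hy) (hU.wellInv_ne_bottom hy0)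
  have hquot : deriv (wellInv U a b) =ᶠ[𝓝 y] fun z => z / -f (wellInv U a b z) := by
    filter_upwards [isOpen_ne.mem_nhds hy0, lt_mem_nhds hy] with z hz0 hz
      using (hU.hasDerivAt_wellInv_of_ne hz hz0).deriv
  refine (((hasDerivAt_id y).div (hf.comp y (hU.hasDerivAt_wellInv_of_ne hy hy0)).neg
    (neg_ne_zero.2 hne)).congr_of_eventuallyEq hquot).congr_deriv ?_
  rw [hU.two_mul_potential_wellInv hy]
  simp only [id, Pi.neg_apply, Function.comp_apply]
  field_simp
  ring

lemma continuousOn_deriv_wellInv_add (hU : IsPotentialWell U f a b κ) :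
    ContinuousOn (fun y => deriv (wellInv U a b) y + deriv (wellInv U a b) (-y))
      (Ico 0 (wellRadius U a b)) := fun y hy =>
  ((hU.continuousAt_deriv_wellInv (by linarith [hU.wellRadius_pos, hy.1])).add
    ((hU.continuousAt_deriv_wellInv (neg_lt_neg hy.2)).comp continuousAt_neg)).continuousWithinAt

/-- A form of the classical criterion that the period increases with the energy: the second
derivative of `wellInv` exceeds `-m` on the right of `0` and is below `-m` on the left. -/
lemma strictMonoOn_deriv_wellInv_add (hU : IsPotentialWell U f a b κ) {f' : ℝ → ℝ} {m : ℝ}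
    (hf : ∀ x, a < x → HasDerivAt f (f' x) x)
    (hcrit : ∀ x, a < x → x ≠ b → 0 < f x ^ 2 + 2 * (U x - U b) * f' x + m * (-f x) ^ 3) :
    StrictMonoOn (fun y => deriv (wellInv U a b) y + deriv (wellInv U a b) (-y))
      (Ico 0 (wellRadius U a b)) := by
  refine strictMonoOn_of_deriv_pos (convex_Ico _ _) hU.continuousOn_deriv_wellInv_add
    fun y hy => ?_
  rw [interior_Ico] at hy
  have hpos : -wellRadius U a b < y := by linarith [hU.wellRadius_pos, hy.1]
  have hneg : -wellRadius U a b < -y := neg_lt_neg hy.2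
  have hright := hU.hasDerivAt_deriv_wellInv hpos hy.1.ne' (hf _ (hU.lt_wellInv hpos))
  have hleft := hU.hasDerivAt_deriv_wellInv hneg (neg_ne_zero.2 hy.1.ne')
    (hf _ (hU.lt_wellInv hneg))
  have hsum := hright.add (hleft.comp y (hasDerivAt_neg y))
  rw [mul_neg_one, ← sub_eq_add_neg] at hsum
  refine (sub_pos.2 ?_).trans_eq hsum.deriv.symm
  have hb : b < wellInv U a b y := by
    have hlt := hU.strictMono_wellInv hy.1
    rwa [hU.wellInv_zero] at hlt
  have hb' : wellInv U a b (-y) < b := by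
    have hlt := hU.strictMono_wellInv (neg_neg_of_pos hy.1)
    rwa [hU.wellInv_zero] at hlt
  refine lt_trans (b := -m) ?_ ?_
  · have hforce := hU.force_pos ⟨hU.lt_wellInv hneg, hb'⟩
    rw [div_lt_iff_of_neg (Odd.pow_neg (by decide) (neg_neg_of_pos hforce))]
    linarith [hcrit _ (hU.lt_wellInv hneg) hb'.ne]
  · rw [lt_div_iff₀ (pow_pos (neg_pos.2 (hU.force_neg hb)) 3)]
    linarith [hcrit _ (hU.lt_wellInv hpos) hb.ne']

lemma hasDerivAt_comp_wellInv_mul_sin (hU : IsPotentialWell U f a b κ) {J : ℝ → ℝ}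
    (hJ : ∀ x ∈ Ioo a (wellInv U a b (wellRadius U a b)), HasDerivAt J (√(2 * (U a - U x)))⁻¹ x)
    {x : ℝ} (hx : x ∈ Ioo (-(π / 2)) (π / 2)) :
    HasDerivAt (fun x => J (wellInv U a b (wellRadius U a b * sin x)))
      (deriv (wellInv U a b) (wellRadius U a b * sin x)) x := by
  have hradius := hU.wellRadius_sq
  have hR := hU.wellRadius_pos
  have hneg := hU.wellInv_neg_wellRadius
  set R := wellRadius U a b
  have hcos := cos_pos_of_mem_Ioo hx
  have hlt : |R * sin x| < R := by
    rw [← sq_lt_sq₀ (abs_nonneg _) hR.le, sq_abs, mul_pow, sin_sq]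
    nlinarith [mul_pos (pow_pos hR 2) (pow_pos hcos 2)]
  obtain ⟨hlt1, hlt2⟩ := abs_lt.1 hlt
  have hspeed : √(2 * (U a - U (wellInv U a b (R * sin x)))) = R * cos x := by
    rw [← sqrt_sq (mul_pos hR hcos).le]
    congr 1
    linear_combination -hU.two_mul_potential_wellInv hlt1 - hradius - R ^ 2 * sin_sq_add_cos_sq x
  have hsin : HasDerivAt (fun x => R * sin x) (R * cos x) x := (hasDerivAt_sin x).const_mul R
  refine ((hJ _ ⟨hU.lt_wellInv hlt1, hU.strictMono_wellInv hlt2⟩).comp x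
    ((hU.hasDerivAt_wellInv hlt1).comp x hsin)).congr_deriv ?_
  rw [hspeed, mul_left_comm, inv_mul_cancel₀ (mul_pos hR hcos).ne', mul_one]

lemma wellInv_wellRadius (hU : IsPotentialWell U f a b κ) {x : ℝ} (hx : b < x) (hUx : U x = U a) :
    wellInv U a b (wellRadius U a b) = x := by
  have hax := (hU.lt.trans hx).le
  have hcoord : wellCoord U a b x = wellRadius U a b := by
    rw [wellRadius, ← hUx, ← hU.wellRoot_sq hax, sqrt_sq (hU.wellRoot_pos hx).le,
      wellCoord_of_le hax]
  rw [← hcoord, hU.wellInv_wellCoord]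

/-- The antiderivative `J` measures the time along the motion of energy `U a`. -/
lemma integrable_and_wellHalfPeriod_wellRadius (hU : IsPotentialWell U f a b κ) {J : ℝ → ℝ}
    (hJ : ContinuousOn J (Icc a (wellInv U a b (wellRadius U a b))))
    (hJ' : ∀ x ∈ Ioo a (wellInv U a b (wellRadius U a b)),
      HasDerivAt J (√(2 * (U a - U x)))⁻¹ x) :
    IntervalIntegrable (fun x => deriv (wellInv U a b) (wellRadius U a b * sin x)
        + deriv (wellInv U a b) (-(wellRadius U a b * sin x))) MeasureTheory.volume 0 (π / 2) ∧
      wellHalfPeriod U a b (wellRadius U a b)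
        = J (wellInv U a b (wellRadius U a b)) - J a := by
  have hmono := hU.strictMono_wellInv.monotone
  have hmaps (x : ℝ) :
      wellInv U a b (wellRadius U a b * sin x) ∈ Icc a (wellInv U a b (wellRadius U a b)) := by
    have hle := hmono (show -wellRadius U a b ≤ wellRadius U a b * sin x by
      nlinarith [neg_one_le_sin x, hU.wellRadius_pos])
    rw [hU.wellInv_neg_wellRadius] at hle
    exact ⟨hle, hmono (by nlinarith [sin_le_one x, hU.wellRadius_pos])⟩
  have hcont : Continuous fun x => J (wellInv U a b (wellRadius U a b * sin x)) :=
    hJ.comp_continuous (hU.continuous_wellInv.comp (by fun_prop)) hmaps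
  have hderiv (x : ℝ) (hx : x ∈ Ioo 0 (π / 2)) := by
    have hright := hU.hasDerivAt_comp_wellInv_mul_sin hJ' ⟨by linarith [hx.1, hx.2], hx.2⟩
    have hleft := hU.hasDerivAt_comp_wellInv_mul_sin (x := -x) hJ'
      ⟨neg_lt_neg hx.2, by linarith [hx.1, hx.2]⟩
    exact hright.sub (hleft.comp x (hasDerivAt_neg x))
  simp only [sub_neg_eq_add, sin_neg, mul_neg, mul_one] at hderiv
  obtain ⟨hint, heq⟩ := integrable_and_integral_eq_sub_of_deriv_nonneg (by positivity)
    (hcont.sub (hcont.comp continuous_neg)).continuousOn hderiv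
    fun x _ => add_nonneg hmono.deriv_nonneg hmono.deriv_nonneg
  refine ⟨hint, heq.trans ?_⟩
  simp only [Pi.sub_apply, Function.comp_apply, sin_neg, sin_pi_div_two, neg_zero, sin_zero,
    mul_zero, mul_one, mul_neg, hU.wellInv_neg_wellRadius, sub_self, sub_zero]

theorem strictMonoOn_and_continuousOn_wellHalfPeriod (hU : IsPotentialWell U f a b κ)
    (hmono : StrictMonoOn (fun y => deriv (wellInv U a b) y + deriv (wellInv U a b) (-y))
      (Ico 0 (wellRadius U a b)))
    (hint : IntervalIntegrable (fun x => deriv (wellInv U a b) (wellRadius U a b * sin x)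
      + deriv (wellInv U a b) (-(wellRadius U a b * sin x))) MeasureTheory.volume 0 (π / 2)) :
    StrictMonoOn (wellHalfPeriod U a b) (Icc 0 (wellRadius U a b)) ∧
      ContinuousOn (wellHalfPeriod U a b) (Icc 0 (wellRadius U a b)) := by
  have hmem {r : ℝ} (hr : r ∈ Icc 0 (wellRadius U a b)) {x : ℝ} (hx : x ∈ Ioo 0 (π / 2)) :
      r * sin x ∈ Ico 0 (wellRadius U a b) := mul_sin_mem_Ico hr hU.wellRadius_pos hx
  have hstrict (x : ℝ) (hx : x ∈ Ioo 0 (π / 2)) : StrictMonoOn (fun r => deriv (wellInv U a b)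
      (r * sin x) + deriv (wellInv U a b) (-(r * sin x))) (Icc 0 (wellRadius U a b)) :=
    hmono.comp ((strictMono_mul_right_of_pos (sin_mem_Ioo hx).1).strictMonoOn _)
      fun r hr => hmem hr hx
  have hmeas (r : ℝ) (hr : r ∈ Icc 0 (wellRadius U a b)) : ContinuousOn (fun x =>
      deriv (wellInv U a b) (r * sin x) + deriv (wellInv U a b) (-(r * sin x))) (Ioo 0 (π / 2)) :=
    hU.continuousOn_deriv_wellInv_add.comp (by fun_prop) fun x hx => hmem hr hx
  have hnn (x : ℝ) (_ : x ∈ Ioo 0 (π / 2)) : 0 ≤ deriv (wellInv U a b) (0 * sin x)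
      + deriv (wellInv U a b) (-(0 * sin x)) :=
    add_nonneg hU.strictMono_wellInv.monotone.deriv_nonneg
      hU.strictMono_wellInv.monotone.deriv_nonneg
  exact ⟨strictMonoOn_intervalIntegral_of_strictMonoOn_param (by positivity) hstrict hmeas hnn hint,
    continuousOn_intervalIntegral_of_monotoneOn_param (by positivity)
      (fun x hx => (hstrict x hx).monotoneOn)
      (fun x hx => hU.continuousOn_deriv_wellInv_add.comp (by fun_prop) fun r hr => hmem hr hx)
      hmeas hnn hint⟩

end HalfPeriod

end IsPotentialWell

end PotentialWell

namespace SublinearOscillator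

open Set Filter Topology MeasureTheory Real

/-- The potential `x² / 2 - |x|^(1+q) / (1+q)` of the equation `w'' + w = w |w|^(q-1)`. -/
noncomputable def potential (q x : ℝ) : ℝ := x ^ 2 / 2 - |x| ^ (1 + q) / (1 + q)

/-- The force `x |x|^(q-1) - x` of the equation `w'' + w = w |w|^(q-1)`. -/
noncomputable def force (q x : ℝ) : ℝ := x * |x| ^ (q - 1) - x

variable {q : ℝ}

@[simp] lemma potential_neg (x : ℝ) : potential q (-x) = potential q x := by
  simp only [potential, even_two.neg_pow, abs_neg]

@[simp] lemma force_neg (x : ℝ) : force q (-x) = -force q x := by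
  simp only [force, abs_neg]
  ring

lemma potential_zero (hq : 0 < q) : potential q 0 = 0 := by
  simp [potential, zero_rpow (by linarith : 1 + q ≠ 0)]

lemma hasDerivAt_potential (hq : 0 < q) (x : ℝ) : HasDerivAt (potential q) (-force q x) x := by
  have hpow := hasDerivAt_abs_rpow x (p := 1 + q) (by linarith)
  refine (((hasDerivAt_pow 2 x).div_const 2).sub (hpow.div_const (1 + q))).congr_deriv ?_
  rw [show 1 + q - 2 = q - 1 by ring, force]
  field_simp
  ring

lemma continuous_potential (hq : 0 < q) : Continuous (potential q) :=
  continuous_iff_continuousAt.2 fun x => (hasDerivAt_potential hq x).continuousAt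

lemma continuous_force (hq : 0 < q) : Continuous (force q) := by
  have hnorm : ContDiff ℝ 1 fun x : ℝ => ‖x‖ ^ (1 + q) := contDiff_norm_rpow (by linarith)
  have hpot : ContDiff ℝ 1 (potential q) :=
    ((contDiff_id.pow 2).div_const 2).sub (hnorm.div_const (1 + q))
  have hderiv : deriv (potential q) = -force q := funext fun x => (hasDerivAt_potential hq x).deriv
  rw [← neg_neg (force q), ← hderiv]
  exact (hpot.continuous_deriv le_rfl).neg

lemma contDiffAt_force {x : ℝ} (hx : x ≠ 0) : ContDiffAt ℝ 1 (force q) x :=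
  (contDiffAt_id.mul ((contDiffAt_abs hx).rpow_const_of_ne (abs_ne_zero.2 hx))).sub contDiffAt_id

lemma isODESolution_iff (hq : 0 < q) {w : ℝ → ℝ} :
    IsODESolution 1 1 q w ↔ IsNewtonSolution (force q) w := by
  refine ⟨fun ⟨hw, heq⟩ => ?_, fun hw => ⟨?_, fun t => ?_⟩⟩
  · rw [← one_add_one_eq_two, contDiff_succ_iff_deriv] at hw
    refine ⟨fun t => (hw.1 t).hasDerivAt,
      fun t => ((hw.2.2.differentiable one_ne_zero) t).hasDerivAt.congr_deriv ?_⟩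
    rw [force]
    linarith [heq t]
  · rw [← one_add_one_eq_two, contDiff_succ_iff_deriv, contDiff_one_iff_deriv,
      funext fun t => (hw.hasDerivAt_deriv t).deriv]
    exact ⟨fun t => (hw.hasDerivAt t).differentiableAt, by simp,
      fun t => (hw.hasDerivAt_deriv t).differentiableAt, (continuous_force hq).comp hw.continuous⟩
  · rw [(hw.hasDerivAt_deriv t).deriv, force]
    ring

section Solution

variable {v w : ℝ → ℝ}

lemma neg_isNewtonSolution (hw : IsNewtonSolution (force q) w) : IsNewtonSolution (force q) (-w) :=
  .of_hasDerivAt (z := -deriv w) (fun t => (hw.hasDerivAt t).neg)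
    fun t => (hw.hasDerivAt_deriv t).neg.congr_deriv (force_neg _).symm

lemma energy_eq (hq : 0 < q) (hw : IsNewtonSolution (force q) w) (s t : ℝ) :
    energy (potential q) (w s) (deriv w s) = energy (potential q) (w t) (deriv w t) :=
  hw.energy_eq (hasDerivAt_potential hq) s t

/-- The origin, the only point of the phase plane where uniqueness fails, has energy zero. -/
lemma isTimeShift_of_energy_ne_zero (hq : 0 < q) (hv : IsNewtonSolution (force q) v)
    (hw : IsNewtonSolution (force q) w) {s : ℝ}
    (hne : energy (potential q) (v s) (deriv v s) ≠ 0)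
    (hs : (v s, deriv v s) ∈ phaseOrbit w) : IsTimeShift v w := by
  obtain ⟨t, ht⟩ := hs
  refine hv.isTimeShift_of_phase_eq (continuous_force hq) hw (fun r => ?_) ht.symm
  obtain ⟨hpos, hvel⟩ := Prod.mk.inj ht
  rw [← hpos, ← hvel, energy_eq hq hw t r] at hne
  by_contra! hrest
  rcases eq_or_ne (w r) 0 with h0 | h0
  · exact hne (by simp [energy, h0, hrest.2, potential_zero hq])
  · exact hrest.1 (contDiffAt_force h0)

end Solution

/-- The quotient `(1 - |s|^(1+q)) / (1 - s²)`, extended by continuity to `s = ±1`. -/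
noncomputable def powQuotient (q s : ℝ) : ℝ := dslope (fun x : ℝ => x ^ ((1 + q) / 2)) 1 (s ^ 2)

lemma sq_rpow_half (s : ℝ) : (s ^ 2) ^ ((1 + q) / 2) = |s| ^ (1 + q) := by
  rw [← sq_abs, ← rpow_natCast, ← rpow_mul (abs_nonneg s)]
  congr 1
  push_cast
  ring

lemma one_sub_sq_mul_powQuotient (s : ℝ) : (1 - s ^ 2) * powQuotient q s = 1 - |s| ^ (1 + q) := by
  have h := sub_smul_dslope (fun x : ℝ => x ^ ((1 + q) / 2)) 1 (s ^ 2)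
  simp only [smul_eq_mul, one_rpow, sq_rpow_half] at h
  rw [powQuotient]
  linarith

lemma powQuotient_of_sq_eq_one {s : ℝ} (hs : s ^ 2 = 1) : powQuotient q s = (1 + q) / 2 := by
  rw [powQuotient, hs, dslope_same,
    (hasDerivAt_rpow_const (p := (1 + q) / 2) (Or.inl one_ne_zero)).deriv, one_rpow, mul_one]

@[simp] lemma powQuotient_neg (s : ℝ) : powQuotient q (-s) = powQuotient q s := by
  simp only [powQuotient, even_two.neg_pow]

lemma continuous_powQuotient (hq : 0 < q) : Continuous (powQuotient q) := by
  have h : Continuous (dslope (fun x : ℝ => x ^ ((1 + q) / 2)) 1) := by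
    rw [← continuousOn_univ, continuousOn_dslope univ_mem]
    exact ⟨(continuous_rpow_const (by positivity)).continuousOn,
      (hasDerivAt_rpow_const (Or.inl one_ne_zero)).differentiableAt⟩
  exact h.comp (continuous_pow 2)

lemma powQuotient_pos (hq : 0 < q) (s : ℝ) : 0 < powQuotient q s := by
  have hmul := one_sub_sq_mul_powQuotient (q := q) s
  rw [← sq_rpow_half] at hmul
  rcases lt_trichotomy (s ^ 2) 1 with hs | hs | hs
  · have := rpow_lt_one (sq_nonneg s) hs (by positivity : 0 < (1 + q) / 2)
    nlinarith
  · rw [powQuotient_of_sq_eq_one hs]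
    positivity
  · have := one_lt_rpow hs (by positivity : 0 < (1 + q) / 2)
    nlinarith

lemma powQuotient_lt_one (hq : q < 1) {s : ℝ} (hs0 : s ≠ 0) : powQuotient q s < 1 := by
  have hmul := one_sub_sq_mul_powQuotient (q := q) s
  have hexp : (1 + q) / 2 < 1 := by linarith
  have hpos : 0 < s ^ 2 := by positivity
  rw [← sq_rpow_half] at hmul
  rcases lt_trichotomy (s ^ 2) 1 with hs | hs | hs
  · have := rpow_lt_rpow_of_exponent_gt hpos hs hexp
    rw [rpow_one] at this
    nlinarith
  · rwa [powQuotient_of_sq_eq_one hs]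
  · have := rpow_lt_rpow_of_exponent_lt hs hexp
    rw [rpow_one] at this
    nlinarith

lemma powQuotient_le_one (hq0 : 0 < q) (hq1 : q < 1) (s : ℝ) : powQuotient q s ≤ 1 := by
  rcases eq_or_ne s 0 with rfl | hs
  · have hmul := one_sub_sq_mul_powQuotient (q := q) 0
    rw [abs_zero, zero_rpow (by linarith)] at hmul
    linarith
  · exact (powQuotient_lt_one hq1 hs).le

/-- The squared angular speed, in the coordinate `x` with `w = A sin x`, of the sign-changing
solution `w` of maximum `A = amplitude q c`. -/
noncomputable def speedSq (q c x : ℝ) : ℝ := 1 - c * powQuotient q (sin x)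

lemma continuous_speedSq (hq : 0 < q) (c : ℝ) : Continuous (speedSq q c) :=
  continuous_const.sub (continuous_const.mul ((continuous_powQuotient hq).comp continuous_sin))

lemma one_sub_mul_powQuotient_pos (hq0 : 0 < q) (hq1 : q < 1) {c : ℝ} (hc : c ∈ Ico (0 : ℝ) 1)
    (s : ℝ) : 0 < 1 - c * powQuotient q s := by
  nlinarith [powQuotient_pos hq0 s, powQuotient_le_one hq0 hq1 s, hc.1, hc.2]

lemma speedSq_pos (hq0 : 0 < q) (hq1 : q < 1) {c : ℝ} (hc : c ∈ Ico (0 : ℝ) 1) (x : ℝ) :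
    0 < speedSq q c x :=
  one_sub_mul_powQuotient_pos hq0 hq1 hc _

lemma cos_sq_mul_speedSq (c x : ℝ) :
    cos x ^ 2 * speedSq q c x = cos x ^ 2 - c * (1 - |sin x| ^ (1 + q)) := by
  rw [speedSq, ← one_sub_sq_mul_powQuotient (sin x), ← cos_sq']
  ring

lemma hasDerivAt_cos_mul_sqrt_speedSq (hq0 : 0 < q) (hq1 : q < 1) {c : ℝ}
    (hc : c ∈ Ico (0 : ℝ) 1) (x : ℝ) :
    HasDerivAt (fun x => cos x * √(speedSq q c x))
      (sin x * ((1 + q) / 2 * c * |sin x| ^ (q - 1) - 1) * (√(speedSq q c x))⁻¹) x := by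
  have hpos := speedSq_pos hq0 hq1 hc x
  have hsq := sq_sqrt hpos.le
  have hsqrt : √(speedSq q c x) ≠ 0 := (sqrt_pos.2 hpos).ne'
  have hcont := (continuous_speedSq hq0 c).sqrt
  by_cases hcos : cos x = 0
  · have hsin : sin x ^ 2 = 1 := by rw [sin_sq, hcos, sq, mul_zero, sub_zero]
    have habs : |sin x| = 1 := by rw [← sqrt_sq_eq_abs, hsin, sqrt_one]
    refine (hasDerivAt_mul_of_eq_zero (hasDerivAt_cos x) hcos hcont.continuousAt).congr_deriv ?_
    rw [habs, one_rpow, eq_mul_inv_iff_mul_eq₀ hsqrt, mul_assoc, ← sq,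
      hsq, speedSq, powQuotient_of_sq_eq_one hsin]
    ring
  · have habs := (hasDerivAt_abs_rpow (sin x) (p := 1 + q) (by linarith)).comp x (hasDerivAt_sin x)
    have hprod : HasDerivAt (fun y => (cos y * √(speedSq q c y)) ^ 2) _ x :=
      (((hasDerivAt_cos x).fun_pow 2).sub ((habs.const_sub 1).const_mul c)).congr_of_eventuallyEq
        (Eventually.of_forall fun y => by
          simp only [mul_pow, sq_sqrt (speedSq_pos hq0 hq1 hc y).le, cos_sq_mul_speedSq,
            Pi.sub_apply, Function.comp_apply])
    refine (hasDerivAt_of_hasDerivAt_sq (continuous_cos.fun_mul hcont).continuousAt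
      (mul_ne_zero hcos hsqrt) hprod).congr_deriv ?_
    rw [show 1 + q - 2 = q - 1 by ring]
    field_simp
    ring

/-- A quarter of the period of the sign-changing solution of maximum `amplitude q c`. -/
noncomputable def quarterPeriod (q c : ℝ) : ℝ := ∫ x in (0)..(π / 2), (√(speedSq q c x))⁻¹

lemma integral_inv_sqrt_speedSq (hq0 : 0 < q) (hq1 : q < 1) {c : ℝ} (hc : c ∈ Ico (0 : ℝ) 1) :
    ∫ x in (0)..(2 * π), (√(speedSq q c x))⁻¹ = 4 * quarterPeriod q c := by
  have hcont : Continuous fun x => (√(speedSq q c x))⁻¹ :=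
    (continuous_speedSq hq0 c).sqrt.inv₀ fun x => (sqrt_pos.2 (speedSq_pos hq0 hq1 hc x)).ne'
  rw [intervalIntegral_two_pi_of_symm hcont (fun x => by simp only [speedSq, sin_add_two_pi])
    (fun x => by simp only [speedSq, sin_pi_sub])]
  have heven (x : ℝ) : speedSq q c (-x) = speedSq q c x := by
    simp only [speedSq, sin_neg, powQuotient_neg]
  simp only [heven, ← two_mul]
  rw [intervalIntegral.integral_const_mul, quarterPeriod]
  ring

lemma quarterPeriod_zero : quarterPeriod q 0 = π / 2 := by
  simp [quarterPeriod, speedSq]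

/-- At `c = 1` the motion is explicit: `(sin x)^((1-q)/2)` is the sine of an angle that rotates
with speed `(1-q)/2`. -/
lemma inv_sqrt_speedSq_one {x : ℝ} (hx : x ∈ Ioo 0 (π / 2)) :
    (√(speedSq q 1 x))⁻¹ = sin x ^ ((1 - q) / 2 - 1) * cos x
      * (√(1 - (sin x ^ ((1 - q) / 2)) ^ 2))⁻¹ := by
  obtain ⟨hsin, -⟩ := sin_mem_Ioo hx
  have hcos : 0 < cos x := cos_pos_of_mem_Ioo ⟨by linarith [hx.1, pi_pos], hx.2⟩
  have hpow (p : ℝ) : (sin x ^ p) ^ 2 = sin x ^ (2 * p) := by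
    rw [← rpow_natCast, ← rpow_mul hsin.le, mul_comm]
    norm_num
  have hfactor : (sin x ^ ((1 - q) / 2 - 1) * cos x) ^ 2 * speedSq q 1 x
      = 1 - (sin x ^ ((1 - q) / 2)) ^ 2 := by
    rw [mul_pow, mul_assoc, cos_sq_mul_speedSq, abs_of_pos hsin, hpow, hpow, cos_sq']
    have hsq : sin x ^ (2 * ((1 - q) / 2 - 1)) * sin x ^ 2 = sin x ^ (2 * ((1 - q) / 2)) := by
      rw [← rpow_natCast, ← rpow_add hsin]
      congr 1
      push_cast
      ring
    have hone : sin x ^ (2 * ((1 - q) / 2 - 1)) * sin x ^ (1 + q) = 1 := by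
      rw [← rpow_add hsin, show 2 * ((1 - q) / 2 - 1) + (1 + q) = 0 by ring, rpow_zero]
    linear_combination hone - hsq
  have hpos : 0 < sin x ^ ((1 - q) / 2 - 1) * cos x := mul_pos (rpow_pos_of_pos hsin _) hcos
  rw [← hfactor, sqrt_mul (sq_nonneg _), sqrt_sq hpos.le, mul_inv, mul_inv_cancel_left₀ hpos.ne']

lemma integrable_and_quarterPeriod_one (hq : q < 1) :
    IntervalIntegrable (fun x => (√(speedSq q 1 x))⁻¹) volume 0 (π / 2) ∧
      quarterPeriod q 1 = π / (1 - q) := by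
  have hδ : 0 < (1 - q) / 2 := by linarith
  have hq' : 1 - q ≠ 0 := by linarith
  let F : ℝ → ℝ := fun x => 2 / (1 - q) * arcsin (sin x ^ ((1 - q) / 2))
  have hF : Continuous F := continuous_const.mul
    (continuous_arcsin.comp ((continuous_rpow_const hδ.le).comp continuous_sin))
  have hderiv : ∀ x ∈ Ioo 0 (π / 2), HasDerivAt F (√(speedSq q 1 x))⁻¹ x := fun x hx => by
    obtain ⟨h0, h1⟩ := sin_mem_Ioo hx
    have hu0 : 0 < sin x ^ ((1 - q) / 2) := rpow_pos_of_pos h0 _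
    have hu1 : sin x ^ ((1 - q) / 2) < 1 := rpow_lt_one h0.le h1 hδ
    have hu := (hasDerivAt_sin x).rpow_const (p := (1 - q) / 2) (Or.inl h0.ne')
    refine (((hasDerivAt_arcsin (by linarith) hu1.ne).comp x hu).const_mul
      (2 / (1 - q))).congr_deriv ?_
    rw [inv_sqrt_speedSq_one hx]
    field_simp
  obtain ⟨hint, heq⟩ := integrable_and_integral_eq_sub_of_deriv_nonneg (by positivity)
    hF.continuousOn hderiv (fun x _ => by positivity)
  refine ⟨hint, ?_⟩
  rw [quarterPeriod, heq]
  simp only [F, sin_pi_div_two, sin_zero, one_rpow, zero_rpow hδ.ne', arcsin_one, arcsin_zero]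
  field_simp
  ring

section ParameterDependence

lemma speedSq_pos_of_mem_Ioo (hq0 : 0 < q) (hq1 : q < 1) {x : ℝ} (hx : x ∈ Ioo 0 (π / 2)) {c : ℝ}
    (hc : c ∈ Icc (0 : ℝ) 1) : 0 < speedSq q c x := by
  have hlt := powQuotient_lt_one hq1 (sin_mem_Ioo hx).1.ne'
  rw [speedSq]
  nlinarith [powQuotient_pos hq0 (sin x), hc.1, hc.2]

lemma strictMonoOn_inv_sqrt_speedSq (hq0 : 0 < q) (hq1 : q < 1) {x : ℝ}
    (hx : x ∈ Ioo 0 (π / 2)) : StrictMonoOn (fun c => (√(speedSq q c x))⁻¹) (Icc 0 1) := by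
  intro c _ d hd hcd
  have hpos := speedSq_pos_of_mem_Ioo hq0 hq1 hx hd
  refine inv_strictAnti₀ (sqrt_pos.2 hpos) (sqrt_lt_sqrt hpos.le ?_)
  exact sub_lt_sub_left (mul_lt_mul_of_pos_right hcd (powQuotient_pos hq0 _)) 1

lemma continuousOn_inv_sqrt_speedSq (hq0 : 0 < q) (hq1 : q < 1) {c : ℝ} (hc : c ∈ Icc (0 : ℝ) 1) :
    ContinuousOn (fun x => (√(speedSq q c x))⁻¹) (Ioo 0 (π / 2)) :=
  (continuous_speedSq hq0 c).sqrt.continuousOn.inv₀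
    fun _ hx => (sqrt_pos.2 (speedSq_pos_of_mem_Ioo hq0 hq1 hx hc)).ne'

lemma strictMonoOn_quarterPeriod (hq0 : 0 < q) (hq1 : q < 1) :
    StrictMonoOn (quarterPeriod q) (Icc 0 1) :=
  strictMonoOn_intervalIntegral_of_strictMonoOn_param (by positivity)
    (fun _ hx => strictMonoOn_inv_sqrt_speedSq hq0 hq1 hx)
    (fun _ hc => continuousOn_inv_sqrt_speedSq hq0 hq1 hc) (fun x _ => by positivity)
    (integrable_and_quarterPeriod_one hq1).1

lemma continuousOn_quarterPeriod (hq0 : 0 < q) (hq1 : q < 1) :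
    ContinuousOn (quarterPeriod q) (Icc 0 1) := by
  refine continuousOn_intervalIntegral_of_monotoneOn_param (by positivity)
    (fun x hx => (strictMonoOn_inv_sqrt_speedSq hq0 hq1 hx).monotoneOn) (fun x hx => ?_)
    (fun _ hc => continuousOn_inv_sqrt_speedSq hq0 hq1 hc) (fun x _ => by positivity)
    (integrable_and_quarterPeriod_one hq1).1
  refine ContinuousOn.inv₀ (Continuous.continuousOn ?_)
    fun c hc => (sqrt_pos.2 (speedSq_pos_of_mem_Ioo hq0 hq1 hx hc)).ne'
  unfold speedSq
  fun_prop

end ParameterDependence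

/-- The maximum `A` of the sign-changing solution with parameter `c`, so that
`A^(q-1) = (1+q)/2 * c`. The parameter runs through `(0, 1)`, large amplitudes having small `c`. -/
noncomputable def amplitude (q c : ℝ) : ℝ := ((1 + q) / 2 * c) ^ (q - 1)⁻¹

lemma amplitude_pos (hq : 0 < q) {c : ℝ} (hc : 0 < c) : 0 < amplitude q c :=
  rpow_pos_of_pos (by positivity) _

lemma amplitude_rpow (hq0 : 0 < q) (hq1 : q < 1) {c : ℝ} (hc : 0 < c) :
    amplitude q c ^ (q - 1) = (1 + q) / 2 * c :=
  rpow_inv_rpow (by positivity) (by linarith)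

lemma exists_amplitude_eq (hq0 : 0 < q) (hq1 : q < 1) {A : ℝ} (hA : 0 < A) :
    ∃ c, 0 < c ∧ amplitude q c = A := by
  refine ⟨2 / (1 + q) * A ^ (q - 1), by positivity, ?_⟩
  have hcancel : (1 + q) / 2 * (2 / (1 + q) * A ^ (q - 1)) = A ^ (q - 1) := by field_simp
  rw [amplitude, hcancel, rpow_rpow_inv hA.le (by linarith)]

lemma force_amplitude_mul (hq0 : 0 < q) (hq1 : q < 1) {c : ℝ} (hc : 0 < c) (s : ℝ) :
    force q (amplitude q c * s)
      = amplitude q c * (s * ((1 + q) / 2 * c * |s| ^ (q - 1) - 1)) := by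
  have hA := amplitude_pos hq0 hc
  rw [force, abs_mul, abs_of_pos hA, mul_rpow hA.le (abs_nonneg s), amplitude_rpow hq0 hq1 hc]
  ring

lemma potential_amplitude_sub (hq0 : 0 < q) (hq1 : q < 1) {c : ℝ} (hc : 0 < c) (s : ℝ) :
    2 * (potential q (amplitude q c) - potential q (amplitude q c * s))
      = amplitude q c ^ 2 * ((1 - s ^ 2) * (1 - c * powQuotient q s)) := by
  have hA := amplitude_pos hq0 hc
  have hpow : amplitude q c ^ (1 + q) = amplitude q c ^ 2 * ((1 + q) / 2 * c) := by
    rw [← amplitude_rpow hq0 hq1 hc, ← rpow_natCast, ← rpow_add hA]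
    congr 1
    push_cast
    ring
  rw [mul_sub (1 - s ^ 2), mul_left_comm, one_sub_sq_mul_powQuotient]
  simp only [potential, abs_mul, abs_of_pos hA, mul_rpow hA.le (abs_nonneg s), hpow]
  field_simp
  ring

lemma energy_amplitude_mul_eq_iff (hq0 : 0 < q) (hq1 : q < 1) {c : ℝ} (hc : 0 < c) (s y : ℝ) :
    energy (potential q) (amplitude q c * s) (amplitude q c * y) = potential q (amplitude q c) ↔
      y ^ 2 = (1 - s ^ 2) * (1 - c * powQuotient q s) := by
  rw [← mul_right_inj' (pow_pos (amplitude_pos hq0 hc) 2).ne' (b := y ^ 2),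
    ← potential_amplitude_sub hq0 hq1 hc, energy, mul_pow]
  constructor <;> intro h <;> linarith

lemma range_amplitude_mul_sin_cos (hq0 : 0 < q) (hq1 : q < 1) {c : ℝ} (hc : c ∈ Ioo (0 : ℝ) 1) :
    range (fun x => (amplitude q c * sin x, amplitude q c * (cos x * √(speedSq q c x))))
      = {p | energy (potential q) p.1 p.2 = potential q (amplitude q c)} := by
  have hA := amplitude_pos hq0 hc.1
  ext ⟨x, y⟩
  obtain ⟨s, rfl⟩ : ∃ s, amplitude q c * s = x := ⟨x / amplitude q c, mul_div_cancel₀ x hA.ne'⟩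
  obtain ⟨z, rfl⟩ : ∃ z, amplitude q c * z = y := ⟨y / amplitude q c, mul_div_cancel₀ y hA.ne'⟩
  simp only [mem_range, Prod.mk.injEq, mul_right_inj' hA.ne', mem_ofPred_eq,
    energy_amplitude_mul_eq_iff hq0 hq1 hc.1]
  have hspeed := one_sub_mul_powQuotient_pos hq0 hq1 (Ioo_subset_Ico_self hc) s
  constructor
  · rintro ⟨θ, rfl, rfl⟩
    rw [mul_pow, ← cos_sq', speedSq, sq_sqrt hspeed.le]
  · intro hz
    have hs : s ^ 2 ≤ 1 := sub_nonneg.1 (nonneg_of_mul_nonneg_left (hz ▸ sq_nonneg z) hspeed)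
    obtain ⟨hs1, hs2⟩ := abs_le.1 ((sq_le_one_iff_abs_le_one s).1 hs)
    have hsin := sin_arcsin hs1 hs2
    have hz2 : z ^ 2 = (cos (arcsin s) * √(speedSq q c (arcsin s))) ^ 2 := by
      rw [hz, mul_pow, cos_sq', speedSq, hsin, sq_sqrt hspeed.le]
    rcases sq_eq_sq_iff_eq_or_eq_neg.1 hz2 with hpos | hneg
    · exact ⟨arcsin s, hsin, hpos.symm⟩
    · refine ⟨π - arcsin s, by rw [sin_pi_sub, hsin], ?_⟩
      rw [hneg, cos_pi_sub, speedSq, speedSq, sin_pi_sub, neg_mul]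

theorem exists_oscillation (hq0 : 0 < q) (hq1 : q < 1) {c : ℝ} (hc : c ∈ Ioo (0 : ℝ) 1) :
    ∃ w : ℝ → ℝ, IsNewtonSolution (force q) w ∧ IsSignChanging w ∧
      phaseOrbit w = {p | energy (potential q) p.1 p.2 = potential q (amplitude q c)} ∧
      HasLeastPeriod w (4 * quarterPeriod q c) := by
  have hA := amplitude_pos hq0 hc.1
  have hc' := Ioo_subset_Ico_self hc
  have hsqrt (x : ℝ) : 0 < √(speedSq q c x) := sqrt_pos.2 (speedSq_pos hq0 hq1 hc' x)
  obtain ⟨w, hw, horbit, hleast⟩ := IsNewtonSolution.exists_of_parametrization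
    (f := force q) (g := fun x => (√(speedSq q c x))⁻¹) (Φ := fun x => amplitude q c * sin x)
    (Ψ := fun x => amplitude q c * (cos x * √(speedSq q c x))) (x₀ := π / 2)
    ((continuous_speedSq hq0 c).sqrt.inv₀ fun x => (hsqrt x).ne')
    (fun x => inv_pos.2 (hsqrt x)) (fun x => by simp only [speedSq, sin_add_two_pi])
    (fun x => ((hasDerivAt_sin x).const_mul _).congr_deriv (by
      rw [mul_assoc, mul_inv_cancel_right₀ (hsqrt x).ne']))
    (fun x => ((hasDerivAt_cos_mul_sqrt_speedSq hq0 hq1 hc' x).const_mul _).congr_deriv (by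
      rw [force_amplitude_mul hq0 hq1 hc.1, mul_assoc (amplitude q c)]))
    (fun x => by simp only [sin_add_two_pi])
    (fun x hx => by
      rw [sin_pi_div_two, mul_right_inj' hA.ne', sin_eq_one_iff] at hx
      exact hx.imp fun n hn => hn.symm)
  rw [integral_inv_sqrt_speedSq hq0 hq1 hc'] at hleast
  have hvalue (x : ℝ) : ∃ t, w t = amplitude q c * sin x := by
    obtain ⟨t, ht⟩ := horbit.ge (mem_range_self x)
    exact ⟨t, congrArg Prod.fst ht⟩
  obtain ⟨a, ha⟩ := hvalue (π / 2)
  obtain ⟨b, hb⟩ := hvalue (-(π / 2))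
  refine ⟨w, hw, ⟨⟨a, ?_⟩, b, ?_⟩, ?_, hleast⟩
  · simpa only [ha, sin_pi_div_two, mul_one]
  · simpa only [hb, sin_neg, sin_pi_div_two, mul_neg, mul_one, neg_lt_zero]
  · rw [horbit, range_amplitude_mul_sin_cos hq0 hq1 hc]

lemma tendsto_potential_atTop (hq : q < 1) : Tendsto (potential q) atTop atTop := by
  have hpow : Tendsto (fun x : ℝ => x ^ (q - 1)) atTop (𝓝 0) := by
    simpa only [neg_sub] using tendsto_rpow_neg_atTop (sub_pos.2 hq)
  have hfactor : Tendsto (fun x : ℝ => 1 / 2 - x ^ (q - 1) / (1 + q)) atTop (𝓝 (1 / 2)) := by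
    simpa only [zero_div, sub_zero] using (hpow.div_const (1 + q)).const_sub (1 / 2)
  refine ((tendsto_pow_atTop two_ne_zero).atTop_mul_pos one_half_pos hfactor).congr' ?_
  filter_upwards [eventually_gt_atTop 0] with x hx
  rw [potential, abs_of_pos hx, show 1 + q = 2 + (q - 1) by ring, rpow_add hx, rpow_two]
  ring

lemma exists_potential_amplitude_eq (hq0 : 0 < q) (hq1 : q < 1) {e : ℝ} (he : 0 < e) :
    ∃ c ∈ Ioo (0 : ℝ) 1, potential q (amplitude q c) = e := by
  obtain ⟨B, hBe, hB⟩ := (((tendsto_potential_atTop hq1).eventually_ge_atTop e).and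
    (eventually_ge_atTop 0)).exists
  obtain ⟨A, hA, rfl⟩ := intermediate_value_Icc hB (continuous_potential hq0).continuousOn
    ⟨(potential_zero hq0).trans_le he.le, hBe⟩
  have hA0 : 0 < A := hA.1.lt_of_ne fun h => he.ne' (by rw [← h, potential_zero hq0])
  obtain ⟨c, hc, rfl⟩ := exists_amplitude_eq hq0 hq1 hA0
  refine ⟨c, ⟨hc, ?_⟩, rfl⟩
  have hsub := potential_amplitude_sub hq0 hq1 hc 0
  have hquot : powQuotient q 0 = 1 := by
    have := one_sub_sq_mul_powQuotient (q := q) 0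
    rw [abs_zero, zero_rpow (by linarith)] at this
    linarith
  rw [mul_zero, potential_zero hq0, hquot] at hsub
  by_contra! hc1
  nlinarith [sq_nonneg (amplitude q c)]

section PeriodCriterion

lemma force_of_pos {x : ℝ} (hx : 0 < x) : force q x = x ^ q - x := by
  rw [force, abs_of_pos hx, rpow_sub_one hx.ne']
  field_simp

lemma force_pos (hq : q < 1) {x : ℝ} (hx0 : 0 < x) (hx : x < 1) : 0 < force q x := by
  rw [force_of_pos hx0, sub_pos]
  simpa only [rpow_one] using rpow_lt_rpow_of_exponent_gt hx0 hx hq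

lemma force_neg_of_one_lt (hq : q < 1) {x : ℝ} (hx : 1 < x) : force q x < 0 := by
  rw [force_of_pos (zero_lt_one.trans hx), sub_neg]
  simpa only [rpow_one] using rpow_lt_rpow_of_exponent_lt hx hq

lemma hasDerivAt_rpow_self {x : ℝ} (hx : 0 < x) :
    HasDerivAt (fun x : ℝ => x ^ q) (q * x ^ q / x) x := by
  refine (hasDerivAt_rpow_const (Or.inl hx.ne')).congr_deriv ?_
  rw [rpow_sub_one hx.ne', mul_div_assoc]

lemma hasDerivAt_force {x : ℝ} (hx : 0 < x) : HasDerivAt (force q) (q * x ^ q / x - 1) x :=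
  ((hasDerivAt_rpow_self hx).sub (hasDerivAt_id x)).congr_of_eventuallyEq (by
    filter_upwards [lt_mem_nhds hx] with y hy using force_of_pos hy)

/-- The left-hand side of the criterion `IsPotentialWell.strictMonoOn_deriv_wellInv_add` for the
well of `potential q` around `1`. -/
noncomputable def criterion (q x : ℝ) : ℝ :=
  force q x ^ 2 + 2 * (potential q x - potential q 1) * (q * x ^ q / x - 1)
    + q / (3 * (1 - q)) * (-force q x) ^ 3

/-- The derivative of `criterion q`, up to a positive factor. -/
noncomputable def criterionSlope (q x : ℝ) : ℝ :=
  force q x ^ 2 * (x ^ 2 / x ^ q - q * x) / (1 - q)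
    - 2 * (1 - q) * (potential q x - potential q 1)

/-- Up to a constant, the quotient of the derivative of `criterionSlope q` by `-force q`. -/
noncomputable def criterionCurvature (q x : ℝ) : ℝ :=
  (4 - q) * (x ^ 2 / x ^ q) - (2 + 4 * q) * x + q * (1 + 2 * q) * x ^ q

lemma hasDerivAt_criterion (hq0 : 0 < q) (hq1 : q < 1) {x : ℝ} (hx : 0 < x) :
    HasDerivAt (criterion q) (q * x ^ q / x ^ 2 * criterionSlope q x) x := by
  have := rpow_pos_of_pos hx q
  have hδ : 1 - q ≠ 0 := by linarith
  have hf := hasDerivAt_force (q := q) hx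
  have hU := ((hasDerivAt_potential hq0 x).sub_const (potential q 1)).const_mul 2
  have hf' := (((hasDerivAt_rpow_self (q := q) hx).const_mul q).div (hasDerivAt_id x)
    hx.ne').sub_const 1
  refine (((hf.pow 2).add (hU.mul hf')).add
    ((hf.neg.pow 3).const_mul (q / (3 * (1 - q))))).congr_deriv ?_
  simp only [criterionSlope, id, Pi.neg_apply, Pi.div_apply]
  field_simp
  norm_num
  ring

lemma hasDerivAt_criterionSlope (hq0 : 0 < q) (hq1 : q < 1) {x : ℝ} (hx : 0 < x) :
    HasDerivAt (criterionSlope q)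
      (-force q x * (criterionCurvature q x - 2 * (1 - q) ^ 2) / (1 - q)) x := by
  have hpow := rpow_pos_of_pos hx q
  have hδ : 1 - q ≠ 0 := by linarith
  have hf := hasDerivAt_force (q := q) hx
  have hU := ((hasDerivAt_potential hq0 x).sub_const (potential q 1)).const_mul (2 * (1 - q))
  have hid := hasDerivAt_id x
  have hquot := ((hid.pow 2).div (hasDerivAt_rpow_self (q := q) hx) hpow.ne').sub (hid.const_mul q)
  refine ((((hf.pow 2).mul hquot).div_const (1 - q)).sub hU).congr_deriv ?_
  simp only [criterionCurvature, force_of_pos hx, id, Pi.pow_apply, Pi.sub_apply, Pi.div_apply]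
  field_simp
  norm_num
  ring

lemma one_sub_rpow_mul_taylor_le_one {n d : ℝ} (hn : 0 ≤ n) (hd0 : 0 ≤ d) (hd1 : d < 1) :
    (1 - d) ^ n * (1 + n * d + n * (n + 1) / 2 * d ^ 2 + n * (n + 1) * (n + 2) / 6 * d ^ 3)
      ≤ 1 := by
  let F : ℝ → ℝ := fun d => (1 - d) ^ n *
    (1 + n * d + n * (n + 1) / 2 * d ^ 2 + n * (n + 1) * (n + 2) / 6 * d ^ 3)
  have hder : ∀ x < 1, HasDerivAt F
      (-((1 - x) ^ (n - 1) * (n * (n + 1) * (n + 2) * (n + 3) / 6 * x ^ 3))) x := fun x hx => by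
    have hpos : 0 < 1 - x := sub_pos.2 hx
    have hid := hasDerivAt_id x
    have hrpow := (hid.const_sub 1).rpow_const (p := n) (Or.inl hpos.ne')
    have hpoly := (((hid.const_mul n).const_add 1).add
      ((hid.pow 2).const_mul (n * (n + 1) / 2))).add
      ((hid.pow 3).const_mul (n * (n + 1) * (n + 2) / 6))
    refine (hrpow.mul hpoly).congr_deriv ?_
    simp only [id, Pi.add_apply, Pi.pow_apply, rpow_sub_one hpos.ne']
    field_simp
    norm_num
    ring
  have hanti : AntitoneOn F (Icc 0 d) := by
    refine antitoneOn_of_hasDerivWithinAt_nonpos (convex_Icc 0 d)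
      (HasDerivAt.continuousOn fun y hy => hder y (hy.2.trans_lt hd1))
      (fun y hy => (hder y ?_).hasDerivWithinAt) (fun y hy => ?_) <;> rw [interior_Icc] at hy
    · exact hy.2.trans hd1
    · have := rpow_nonneg (by linarith [hy.2] : (0 : ℝ) ≤ 1 - y) (n - 1)
      have := hy.1
      exact neg_nonpos.2 (by positivity)
  simpa [F] using hanti ⟨le_rfl, hd0⟩ ⟨hd0, le_rfl⟩ hd0

lemma taylorRemainder_pos (hq0 : 0 < q) (hq1 : q < 1) {d : ℝ} (hd0 : 0 < d) (hd1 : d < 1) :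
    0 < 3 * (6 + 2 * q) * (1 - q) ^ 2 - 6 * (2 - q) * (1 - q) * d + q * (2 - q) * d ^ 2 := by
  obtain ⟨e, rfl⟩ : ∃ e, q = 1 - e := ⟨1 - q, by ring⟩
  have he0 : 0 < e := by linarith
  have hlead : 0 < 1 - e ^ 2 := by nlinarith
  rcases le_or_gt e (2 / 5) with h | h
  · have hdiscr : 0 < e ^ 2 * (1 + e) * (15 - 39 * e + 6 * e ^ 2) := by
      have : 0 < 15 - 39 * e + 6 * e ^ 2 := by nlinarith [sq_nonneg (e - 2 / 5)]
      positivity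
    refine pos_of_mul_pos_right (a := 1 - e ^ 2) ?_ hlead.le
    nlinarith [sq_nonneg ((1 - e ^ 2) * d - 3 * (1 + e) * e)]
  · have hquad : 0 < (1 - e ^ 2) * d ^ 2 := by positivity
    have hlin : 0 < e * ((4 - e) * e - (1 + e) * d) := mul_pos he0 (by nlinarith)
    nlinarith

lemma criterionCurvature_eq {x : ℝ} (hx : 0 < x) :
    criterionCurvature q x = x ^ q * (2 * (1 - q) ^ 2 - 6 * (1 - q) * (1 - x ^ (1 - q))
      + (4 - q) * (1 - x ^ (1 - q)) ^ 2) := by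
  have := rpow_pos_of_pos hx q
  rw [criterionCurvature, rpow_sub hx, rpow_one]
  field_simp
  ring

lemma lt_criterionCurvature (hq0 : 0 < q) (hq1 : q < 1) {x : ℝ} (hx : 1 < x) :
    2 * (1 - q) ^ 2 < criterionCurvature q x := by
  have hδ : 0 < 1 - q := sub_pos.2 hq1
  have hz : 0 < x ^ (1 - q) - 1 := sub_pos.2 (one_lt_rpow hx hδ)
  rw [criterionCurvature_eq (zero_lt_one.trans hx)]
  have hlt : 2 * (1 - q) ^ 2 < 2 * (1 - q) ^ 2 - 6 * (1 - q) * (1 - x ^ (1 - q))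
      + (4 - q) * (1 - x ^ (1 - q)) ^ 2 := by
    nlinarith [mul_pos hδ hz, sq_nonneg (1 - x ^ (1 - q))]
  exact hlt.trans_le (le_mul_of_one_le_left ((by positivity : 0 ≤ 2 * (1 - q) ^ 2).trans hlt.le)
    (one_lt_rpow hx hq0).le)

lemma criterionCurvature_lt (hq0 : 0 < q) (hq1 : q < 1) {x : ℝ} (hx0 : 0 < x) (hx : x < 1) :
    criterionCurvature q x < 2 * (1 - q) ^ 2 := by
  have hδ : 0 < 1 - q := sub_pos.2 hq1
  rw [criterionCurvature_eq hx0]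
  set d := 1 - x ^ (1 - q) with hd
  have hd0 : 0 < d := sub_pos.2 (rpow_lt_one hx0.le hx hδ)
  have hd1 : d < 1 := sub_lt_self 1 (rpow_pos_of_pos hx0 _)
  have hpow : x ^ q = (1 - d) ^ (q / (1 - q)) := by
    rw [hd, sub_sub_cancel, ← rpow_mul hx0.le, mul_div_cancel₀ _ hδ.ne']
  have htaylor := one_sub_rpow_mul_taylor_le_one (n := q / (1 - q)) (by positivity) hd0.le hd1
  rw [← hpow] at htaylor
  refine lt_of_lt_of_le (mul_lt_mul_of_pos_left ?_ (rpow_pos_of_pos hx0 q))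
    ((mul_left_comm _ _ _).trans_le
      (mul_le_of_le_one_right (by positivity : 0 ≤ 2 * (1 - q) ^ 2) htaylor))
  have hremainder := div_pos (mul_pos hd0 (taylorRemainder_pos hq0 hq1 hd0 hd1))
    (by positivity : 0 < 3 * (1 - q))
  refine sub_pos.1 (hremainder.trans_eq ?_)
  field_simp
  ring

lemma strictMonoOn_criterionSlope_Ici (hq0 : 0 < q) (hq1 : q < 1) :
    StrictMonoOn (criterionSlope q) (Ici 1) := by
  have hder (x : ℝ) (hx : 1 ≤ x) :=
    hasDerivAt_criterionSlope hq0 hq1 (zero_lt_one.trans_le hx)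
  refine strictMonoOn_of_hasDerivWithinAt_pos (convex_Ici 1) (HasDerivAt.continuousOn hder)
    (fun x hx => (hder x (interior_subset hx)).hasDerivWithinAt) fun x hx => ?_
  rw [interior_Ici] at hx
  exact div_pos (mul_pos (neg_pos.2 (force_neg_of_one_lt hq1 hx))
    (sub_pos.2 (lt_criterionCurvature hq0 hq1 hx))) (sub_pos.2 hq1)

lemma strictMonoOn_criterionSlope_Ioc (hq0 : 0 < q) (hq1 : q < 1) :
    StrictMonoOn (criterionSlope q) (Ioc 0 1) := by
  have hder (x : ℝ) (hx : x ∈ Ioc 0 1) := hasDerivAt_criterionSlope hq0 hq1 hx.1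
  refine strictMonoOn_of_hasDerivWithinAt_pos (convex_Ioc 0 1) (HasDerivAt.continuousOn hder)
    (fun x hx => (hder x (interior_subset hx)).hasDerivWithinAt) fun x hx => ?_
  rw [interior_Ioc] at hx
  exact div_pos (mul_pos_of_neg_of_neg (neg_neg_of_pos (force_pos hq1 hx.1 hx.2))
    (sub_neg.2 (criterionCurvature_lt hq0 hq1 hx.1 hx.2))) (sub_pos.2 hq1)

lemma force_one : force q 1 = 0 := by
  rw [force_of_pos one_pos, one_rpow, sub_self]

theorem criterion_pos (hq0 : 0 < q) (hq1 : q < 1) {x : ℝ} (hx0 : 0 < x) (hx1 : x ≠ 1) :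
    0 < criterion q x := by
  have hslope : criterionSlope q 1 = 0 := by simp [criterionSlope, force_one]
  have hone : criterion q 1 = 0 := by simp [criterion, force_one]
  rw [← hone]
  have hder (x : ℝ) (hx : 0 < x) := hasDerivAt_criterion hq0 hq1 hx
  rcases hx1.lt_or_gt with hx | hx
  · refine strictAntiOn_of_hasDerivWithinAt_neg (convex_Ioc 0 1)
      (HasDerivAt.continuousOn fun y hy => hder y hy.1)
      (fun y hy => (hder y (interior_subset hy).1).hasDerivWithinAt) (fun y hy => ?_)
      ⟨hx0, hx.le⟩ ⟨one_pos, le_rfl⟩ hx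
    rw [interior_Ioc] at hy
    have := hy.1
    refine mul_neg_of_pos_of_neg (by positivity) (hslope ▸ ?_)
    exact strictMonoOn_criterionSlope_Ioc hq0 hq1 ⟨hy.1, hy.2.le⟩ ⟨one_pos, le_rfl⟩ hy.2
  · refine strictMonoOn_of_hasDerivWithinAt_pos (convex_Ici 1)
      (HasDerivAt.continuousOn fun y hy => hder y (one_pos.trans_le hy))
      (fun y hy => (hder y (one_pos.trans_le (interior_subset hy))).hasDerivWithinAt)
      (fun y hy => ?_) self_mem_Ici hx.le hx
    rw [interior_Ici] at hy
    have hy0 : 0 < y := one_pos.trans hy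
    refine mul_pos (by positivity) (hslope ▸ ?_)
    exact strictMonoOn_criterionSlope_Ici hq0 hq1 self_mem_Ici (mem_Ici.2 (mem_Ioi.1 hy).le) hy

end PeriodCriterion

section PositiveWell

theorem isPotentialWell (hq0 : 0 < q) (hq1 : q < 1) :
    IsPotentialWell (potential q) (force q) 0 1 (1 - q) where
  lt := one_pos
  curvature_pos := sub_pos.2 hq1
  continuousOn := (continuous_potential hq0).continuousOn
  hasDerivAt _ := hasDerivAt_potential hq0 _
  continuousOn_force := (continuous_force hq0).continuousOn
  force_pos hx := force_pos hq1 hx.1 hx.2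
  force_neg := force_neg_of_one_lt hq1
  hasDerivAt_force := (hasDerivAt_force one_pos).congr_deriv (by rw [one_rpow]; ring)
  tendsto := tendsto_potential_atTop hq1

/-- The positive zero of `potential q`, which is the maximum of the nonnegative solution that
touches zero. -/
noncomputable def bumpHeight (q : ℝ) : ℝ := (2 / (1 + q)) ^ (1 - q)⁻¹

lemma bumpHeight_pos (hq : 0 < q) : 0 < bumpHeight q := rpow_pos_of_pos (by positivity) _

lemma one_lt_bumpHeight (hq0 : 0 < q) (hq1 : q < 1) : 1 < bumpHeight q :=
  one_lt_rpow ((one_lt_div (by positivity)).2 (by linarith)) (inv_pos.2 (sub_pos.2 hq1))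

lemma bumpHeight_rpow (hq0 : 0 < q) (hq1 : q < 1) : bumpHeight q ^ (1 - q) = 2 / (1 + q) :=
  rpow_inv_rpow (by positivity) (sub_pos.2 hq1).ne'

lemma neg_two_mul_potential_of_pos (hq0 : 0 < q) (hq1 : q < 1) {x : ℝ} (hx : 0 < x) :
    -(2 * potential q x) = (x / (x / bumpHeight q) ^ ((1 - q) / 2)) ^ 2
      * (1 - ((x / bumpHeight q) ^ ((1 - q) / 2)) ^ 2) := by
  have hB := bumpHeight_pos hq0
  have hpow : x ^ (1 + q) = x ^ 2 / x ^ (1 - q) := by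
    rw [← rpow_two, ← rpow_sub hx]
    congr 1
    ring
  have hsq : ((x / bumpHeight q) ^ ((1 - q) / 2)) ^ 2 = (1 + q) / 2 * x ^ (1 - q) := by
    rw [← rpow_mul_natCast (by positivity), Nat.cast_ofNat, div_mul_cancel₀ _ two_ne_zero,
      div_rpow hx.le hB.le, bumpHeight_rpow hq0 hq1]
    field_simp
  have := rpow_pos_of_pos hx (1 - q)
  rw [div_pow, hsq, potential, abs_of_pos hx, hpow]
  field_simp
  ring

lemma potential_bumpHeight (hq0 : 0 < q) (hq1 : q < 1) : potential q (bumpHeight q) = 0 := by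
  have h := neg_two_mul_potential_of_pos hq0 hq1 (bumpHeight_pos hq0)
  rw [div_self (bumpHeight_pos hq0).ne', one_rpow, one_pow, sub_self, mul_zero] at h
  linarith

/-- The time that the motion of energy zero takes from `0` to `x`: along it,
`(x / bumpHeight q)^((1-q)/2)` is the sine of an angle that rotates with speed `(1-q)/2`. -/
noncomputable def riseTime (q x : ℝ) : ℝ :=
  2 / (1 - q) * arcsin ((x / bumpHeight q) ^ ((1 - q) / 2))

lemma continuous_riseTime (hq : q < 1) : Continuous (riseTime q) :=
  continuous_const.mul (continuous_arcsin.comp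
    ((continuous_rpow_const (by linarith)).comp (continuous_id.div_const _)))

lemma hasDerivAt_riseTime (hq0 : 0 < q) (hq1 : q < 1) {x : ℝ} (hx : x ∈ Ioo 0 (bumpHeight q)) :
    HasDerivAt (riseTime q) (√(2 * (potential q 0 - potential q x)))⁻¹ x := by
  have hx0 := hx.1
  have hB := bumpHeight_pos hq0
  have hδ : 0 < (1 - q) / 2 := by linarith
  have hδ' : 1 - q ≠ 0 := by linarith
  have hpos : 0 < x / bumpHeight q := div_pos hx.1 hB
  set u := (x / bumpHeight q) ^ ((1 - q) / 2) with hu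
  have hu0 : 0 < u := rpow_pos_of_pos hpos _
  have hu1 : u < 1 := rpow_lt_one hpos.le ((div_lt_one hB).2 hx.2) hδ
  have hspeed : √(2 * (potential q 0 - potential q x)) = x / u * √(1 - u ^ 2) := by
    rw [potential_zero hq0, zero_sub, mul_neg, neg_two_mul_potential_of_pos hq0 hq1 hx.1,
      sqrt_mul (sq_nonneg _), sqrt_sq (by positivity)]
  have hderiv := ((hasDerivAt_id x).div_const (bumpHeight q)).rpow_const (p := (1 - q) / 2)
    (Or.inl hpos.ne')
  refine (((hasDerivAt_arcsin (by linarith) hu1.ne).comp x hderiv).const_mul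
    (2 / (1 - q))).congr_deriv ?_
  have hroot : √(1 - u ^ 2) ≠ 0 := (sqrt_pos.2 (by nlinarith)).ne'
  rw [hspeed, id, rpow_sub_one hpos.ne', ← hu]
  field_simp

lemma integrable_and_wellHalfPeriod_one (hq0 : 0 < q) (hq1 : q < 1) :
    IntervalIntegrable (fun x =>
      deriv (wellInv (potential q) 0 1) (wellRadius (potential q) 0 1 * sin x)
        + deriv (wellInv (potential q) 0 1) (-(wellRadius (potential q) 0 1 * sin x)))
      volume 0 (π / 2) ∧
    wellHalfPeriod (potential q) 0 1 (wellRadius (potential q) 0 1) = π / (1 - q) := by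
  have hU := isPotentialWell hq0 hq1
  have htop := hU.wellInv_wellRadius (one_lt_bumpHeight hq0 hq1)
    ((potential_bumpHeight hq0 hq1).trans (potential_zero hq0).symm)
  obtain ⟨hint, heq⟩ := hU.integrable_and_wellHalfPeriod_wellRadius
    (continuous_riseTime hq1).continuousOn
    fun x hx => hasDerivAt_riseTime hq0 hq1 (htop ▸ hx)
  refine ⟨hint, heq.trans ?_⟩
  rw [htop, riseTime, riseTime, div_self (bumpHeight_pos hq0).ne', one_rpow, arcsin_one, zero_div,
    zero_rpow (by linarith), arcsin_zero]
  field_simp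
  ring

theorem strictMonoOn_and_continuousOn_positivePeriod (hq0 : 0 < q) (hq1 : q < 1) :
    StrictMonoOn (wellHalfPeriod (potential q) 0 1) (Icc 0 (wellRadius (potential q) 0 1)) ∧
      ContinuousOn (wellHalfPeriod (potential q) 0 1)
        (Icc 0 (wellRadius (potential q) 0 1)) := by
  have hU := isPotentialWell hq0 hq1
  exact hU.strictMonoOn_and_continuousOn_wellHalfPeriod
    (hU.strictMonoOn_deriv_wellInv_add (fun _ => hasDerivAt_force)
      fun _ => criterion_pos hq0 hq1) (integrable_and_wellHalfPeriod_one hq0 hq1).1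

end PositiveWell

section Bump

lemma hasDerivAt_abs_rpow_mul_self {a : ℝ} (ha : 0 < a) (x : ℝ) :
    HasDerivAt (fun x : ℝ => |x| ^ a * x) ((a + 1) * |x| ^ a) x := by
  rcases eq_or_ne x 0 with rfl | hx
  · have hcont : ContinuousAt (fun x : ℝ => |x| ^ a) 0 :=
      ((continuous_rpow_const ha.le).comp continuous_abs).continuousAt
    simp only [mul_comm (|_| ^ a)]
    exact (hasDerivAt_mul_of_eq_zero (hasDerivAt_id (0 : ℝ)) rfl hcont).congr_deriv
      (by simp [zero_rpow ha.ne'])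
  · have habs : |x| ≠ 0 := abs_ne_zero.2 hx
    refine (((hasDerivAt_abs hx).rpow_const (p := a) (Or.inl habs)).mul
      (hasDerivAt_id x)).congr_deriv ?_
    have hsign : (SignType.sign x : ℝ) * x = |x| := sign_mul_self x
    rw [rpow_sub_one habs, id]
    field_simp
    linear_combination a * hsign

/-- The nonnegative solution of zero energy that vanishes at `0`. -/
noncomputable def bump (q t : ℝ) : ℝ :=
  bumpHeight q * |sin ((1 - q) / 2 * t)| ^ (2 / (1 - q))

/-- The least period of `bump`. -/
noncomputable def bumpPeriod (q : ℝ) : ℝ := 2 * π / (1 - q)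

lemma bumpPeriod_pos (hq : q < 1) : 0 < bumpPeriod q :=
  div_pos two_pi_pos (sub_pos.2 hq)

lemma bump_nonneg (hq : 0 < q) (t : ℝ) : 0 ≤ bump q t :=
  mul_nonneg (bumpHeight_pos hq).le (rpow_nonneg (abs_nonneg _) _)

lemma bump_zero (hq : q < 1) : bump q 0 = 0 := by
  simp [bump, zero_rpow (div_pos two_pos (sub_pos.2 hq)).ne']

lemma bump_eq_zero_iff (hq0 : 0 < q) (hq1 : q < 1) {t : ℝ} :
    bump q t = 0 ↔ ∃ n : ℤ, t = n * bumpPeriod q := by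
  have hδ : 1 - q ≠ 0 := by linarith
  rw [bump, mul_eq_zero, or_iff_right (bumpHeight_pos hq0).ne',
    rpow_eq_zero (abs_nonneg _) (div_ne_zero two_ne_zero hδ), abs_eq_zero, sin_eq_zero_iff]
  refine exists_congr fun n => ?_
  rw [bumpPeriod]
  field_simp
  constructor <;> intro h <;> linarith

lemma bump_pos (hq0 : 0 < q) (hq1 : q < 1) {t : ℝ} (ht : t ∈ Ioo 0 (bumpPeriod q)) :
    0 < bump q t := by
  refine (bump_nonneg hq0 t).lt_of_ne' fun h0 => ?_
  obtain ⟨n, rfl⟩ := (bump_eq_zero_iff hq0 hq1).1 h0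
  have hL := bumpPeriod_pos hq1
  have hlow : (0 : ℝ) < n := pos_of_mul_pos_left ht.1 hL.le
  have hup : (n : ℝ) < 1 := (mul_lt_iff_lt_one_left hL).1 ht.2
  norm_cast at hlow hup
  omega

lemma periodic_bump (hq : q < 1) : Function.Periodic (bump q) (bumpPeriod q) := fun t => by
  have hδ : 1 - q ≠ 0 := by linarith
  have hangle : (1 - q) / 2 * (t + bumpPeriod q) = (1 - q) / 2 * t + π := by
    rw [bumpPeriod]
    field_simp
  rw [bump, hangle, sin_add_pi, abs_neg, bump]

lemma bump_neg (t : ℝ) : bump q (-t) = bump q t := by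
  simp [bump]

lemma bumpHeight_rpow_self (hq0 : 0 < q) (hq1 : q < 1) :
    bumpHeight q ^ q = (1 + q) / 2 * bumpHeight q := by
  have hB := bumpHeight_pos hq0
  have := rpow_pos_of_pos hB q
  have hquot : bumpHeight q / bumpHeight q ^ q = 2 / (1 + q) := by
    rw [← bumpHeight_rpow hq0 hq1, rpow_sub hB, rpow_one]
  field_simp at hquot ⊢
  linarith

lemma force_of_nonneg (hq : 0 < q) {x : ℝ} (hx : 0 ≤ x) : force q x = x ^ q - x := by
  rcases hx.eq_or_lt with rfl | hx
  · simp [force, zero_rpow hq.ne']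
  · exact force_of_pos hx

lemma force_bump (hq0 : 0 < q) (hq1 : q < 1) (t : ℝ) :
    force q (bump q t) = bumpHeight q * |sin ((1 - q) / 2 * t)| ^ (2 / (1 - q) - 2)
      * ((1 + q) / 2 - sin ((1 - q) / 2 * t) ^ 2) := by
  have hδ : 0 < 1 - q := by linarith
  have hexp : 0 < 2 / (1 - q) - 2 := by
    rw [sub_pos, lt_div_iff₀ hδ]
    linarith
  have hpowq : 2 / (1 - q) * q = 2 / (1 - q) - 2 := by
    field_simp
    ring
  have hpow : |sin ((1 - q) / 2 * t)| ^ (2 / (1 - q))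
      = |sin ((1 - q) / 2 * t)| ^ (2 / (1 - q) - 2) * sin ((1 - q) / 2 * t) ^ 2 := by
    rw [← sq_abs (sin _), ← rpow_two,
      ← rpow_add_of_nonneg (abs_nonneg _) hexp.le zero_le_two, sub_add_cancel]
  rw [force_of_nonneg hq0 (bump_nonneg hq0 t), bump,
    mul_rpow (bumpHeight_pos hq0).le (rpow_nonneg (abs_nonneg _) _), ← rpow_mul (abs_nonneg _),
    hpowq, hpow, bumpHeight_rpow_self hq0 hq1]
  ring

lemma isNewtonSolution_bump (hq0 : 0 < q) (hq1 : q < 1) :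
    IsNewtonSolution (force q) (bump q) := by
  have hδ : 0 < 1 - q := by linarith
  have hexp1 : 1 < 2 / (1 - q) := by rw [lt_div_iff₀ hδ]; linarith
  have hexp2 : 0 < 2 / (1 - q) - 2 := by
    rw [sub_pos, lt_div_iff₀ hδ]
    linarith
  have hangle (t : ℝ) := (hasDerivAt_id t).const_mul ((1 - q) / 2)
  refine .of_hasDerivAt (z := fun t => bumpHeight q * (|sin ((1 - q) / 2 * t)| ^ (2 / (1 - q) - 2)
    * sin ((1 - q) / 2 * t) * cos ((1 - q) / 2 * t))) (fun t => ?_) fun t => ?_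
  · refine (((hasDerivAt_abs_rpow _ hexp1).comp t (hangle t).sin).const_mul
      (bumpHeight q)).congr_deriv ?_
    simp only [id]
    field_simp
  · refine ((((hasDerivAt_abs_rpow_mul_self hexp2 _).comp t (hangle t).sin).mul
      (hangle t).cos).const_mul (bumpHeight q)).congr_deriv ?_
    have hpyth := sin_sq_add_cos_sq ((1 - q) / 2 * t)
    rw [force_bump hq0 hq1, Function.comp_apply]
    simp only [id]
    generalize |sin ((1 - q) / 2 * t)| ^ (2 / (1 - q) - 2) = P
    generalize (1 - q) / 2 * t = θ at hpyth ⊢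
    field_simp
    linear_combination (bumpHeight q * P * (1 + q)) * hpyth

lemma deriv_eq_zero_of_nonneg {v : ℝ → ℝ} (hv : ∀ t, 0 ≤ v t) {t : ℝ} (h0 : v t = 0) :
    deriv v t = 0 :=
  IsLocalMin.deriv_eq_zero (Eventually.of_forall fun s => h0 ▸ hv s)

lemma energy_bump (hq0 : 0 < q) (hq1 : q < 1) (t : ℝ) :
    energy (potential q) (bump q t) (deriv (bump q) t) = 0 := by
  have hzero := bump_zero hq1
  rw [energy_eq hq0 (isNewtonSolution_bump hq0 hq1) t 0, hzero,
    deriv_eq_zero_of_nonneg (bump_nonneg hq0) hzero, energy, potential_zero hq0]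
  ring

lemma le_bumpHeight (hq0 : 0 < q) (hq1 : q < 1) {x y : ℝ} (hx : 0 < x)
    (h : energy (potential q) x y = 0) : x ≤ bumpHeight q := by
  by_contra! hlt
  have hB := bumpHeight_pos hq0
  have hu : 1 < (x / bumpHeight q) ^ ((1 - q) / 2) :=
    one_lt_rpow ((one_lt_div hB).2 hlt) (by linarith)
  have hu2 : 1 - ((x / bumpHeight q) ^ ((1 - q) / 2)) ^ 2 < 0 := by nlinarith
  have hpot : -(2 * potential q x) < 0 := by
    rw [neg_two_mul_potential_of_pos hq0 hq1 hx]
    exact mul_neg_of_pos_of_neg (by positivity) hu2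
  rw [energy] at h
  linarith [sq_nonneg y]

lemma exists_bump_eq (hq0 : 0 < q) (hq1 : q < 1) {x y : ℝ} (hx : 0 < x)
    (h : energy (potential q) x y = 0) :
    ∃ t ∈ Ioo 0 (bumpPeriod q), bump q t = x ∧ deriv (bump q) t = y := by
  have hL := bumpPeriod_pos hq1
  have hδ : 1 - q ≠ 0 := by linarith
  have hzero := bump_zero hq1
  have htop : bump q (bumpPeriod q / 2) = bumpHeight q := by
    rw [bump, bumpPeriod, show (1 - q) / 2 * (2 * π / (1 - q) / 2) = π / 2 by field_simp]
    simp
  obtain ⟨t, ht, rfl⟩ := intermediate_value_Ioc (by linarith : 0 ≤ bumpPeriod q / 2)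
    (isNewtonSolution_bump hq0 hq1).continuous.continuousOn
    (show x ∈ Ioc (bump q 0) (bump q (bumpPeriod q / 2)) from
      ⟨hzero.symm ▸ hx, htop.symm ▸ le_bumpHeight hq0 hq1 hx h⟩)
  have hsq : y ^ 2 = deriv (bump q) t ^ 2 := by
    have := energy_bump hq0 hq1 t
    rw [energy] at h this
    linarith
  rcases sq_eq_sq_iff_eq_or_eq_neg.1 hsq with rfl | rfl
  · exact ⟨t, ⟨ht.1, by linarith [ht.2]⟩, rfl, rfl⟩
  · have hreflect : (fun s => bump q (bumpPeriod q - s)) = bump q := funext fun s => by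
      rw [(periodic_bump hq1).sub_eq', bump_neg]
    refine ⟨bumpPeriod q - t, ⟨by linarith [ht.2], by linarith [ht.1]⟩, congrFun hreflect t, ?_⟩
    have := deriv_comp_const_sub (bump q) (bumpPeriod q) (bumpPeriod q - t)
    rwa [hreflect, sub_sub_cancel] at this

/-- A solution of zero energy may rest at `0` for any time between two bumps, so it agrees with a
translate of `bump` on one period only. -/
lemma exists_eqOn_bump (hq0 : 0 < q) (hq1 : q < 1) {v : ℝ → ℝ}
    (hv : IsNewtonSolution (force q) v) {t₀ : ℝ}
    (hE : energy (potential q) (v t₀) (deriv v t₀) = 0) (hpos : 0 < v t₀) :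
    ∃ σ, EqOn v (fun t => bump q (t - σ)) (Icc σ (σ + bumpPeriod q)) := by
  obtain ⟨t₁, ht₁, hx, hy⟩ := exists_bump_eq hq0 hq1 hpos hE
  let σ := t₀ - t₁
  have hσ : t₀ - σ = t₁ := sub_sub_cancel t₀ t₁
  have hw : IsNewtonSolution (force q) fun t => bump q (t - σ) := by
    simpa only [sub_eq_add_neg] using (isNewtonSolution_bump hq0 hq1).comp_add_const (-σ)
  have heq : EqOn v (fun t => bump q (t - σ)) (Ioo σ (σ + bumpPeriod q)) :=
    hv.eqOn_of_isPreconnected (continuous_force hq0) hw isPreconnected_Ioo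
      (fun t ht => Or.inl (contDiffAt_force
        (bump_pos hq0 hq1 ⟨sub_pos.2 ht.1, sub_lt_iff_lt_add'.2 ht.2⟩).ne'))
      (t₀ := t₀) ⟨by linarith [ht₁.1], by linarith [ht₁.2]⟩ (by rw [hσ, hx])
      (by rw [deriv_comp_sub_const, hσ, hy])
  refine ⟨σ, ?_⟩
  rw [← closure_Ioo (by linarith [bumpPeriod_pos hq1] : σ ≠ σ + bumpPeriod q)]
  exact heq.closure hv.continuous hw.continuous

lemma hasLeastPeriod_bump (hq0 : 0 < q) (hq1 : q < 1) :
    HasLeastPeriod (bump q) (bumpPeriod q) := by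
  refine ⟨⟨bumpPeriod_pos hq1, periodic_bump hq1⟩, fun S ⟨hS, hper⟩ => ?_⟩
  by_contra! hlt
  have hzero : bump q S = 0 := by rw [hper.eq, bump_zero hq1]
  exact (bump_pos hq0 hq1 ⟨hS, hlt⟩).ne' hzero

lemma existsUnique_bump_eq_zero (hq0 : 0 < q) (hq1 : q < 1) (a : ℝ) :
    ∃! t, t ∈ Ico a (a + bumpPeriod q) ∧ bump q t = 0 := by
  obtain ⟨n, hn, huniq⟩ := existsUnique_add_zsmul_mem_Ico (bumpPeriod_pos hq1) 0 a
  simp only [zero_add, zsmul_eq_mul] at hn huniq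
  refine ⟨n * bumpPeriod q, ⟨hn, (bump_eq_zero_iff hq0 hq1).2 ⟨n, rfl⟩⟩, ?_⟩
  rintro t ⟨ht, hzero⟩
  obtain ⟨m, rfl⟩ := (bump_eq_zero_iff hq0 hq1).1 hzero
  rw [huniq m ht]

lemma phaseOrbit_bump (hq0 : 0 < q) (hq1 : q < 1) :
    phaseOrbit (bump q) = {p | 0 ≤ p.1 ∧ energy (potential q) p.1 p.2 = 0} := by
  refine Subset.antisymm ?_ ?_
  · rintro _ ⟨t, rfl⟩
    exact ⟨bump_nonneg hq0 t, energy_bump hq0 hq1 t⟩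
  · rintro ⟨x, y⟩ ⟨hx, hE⟩
    rcases hx.eq_or_lt with rfl | hx
    · have hy : y = 0 := by
        simpa only [energy, potential_zero hq0, add_zero, div_eq_zero_iff, OfNat.ofNat_ne_zero,
          or_false, sq_eq_zero_iff] using hE
      exact ⟨0, Prod.ext (bump_zero hq1)
        ((deriv_eq_zero_of_nonneg (bump_nonneg hq0) (bump_zero hq1)).trans hy.symm)⟩
    · obtain ⟨t, -, hpos, hvel⟩ := exists_bump_eq hq0 hq1 hx hE
      exact ⟨t, Prod.ext hpos hvel⟩

end Bump

/-- Up to time shifts, `w` is the only solution of `w'' + μ w = w |w|^(q-1)` with least period `T`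
that belongs to the class `C`. -/
def IsUniqueSolution (μ q T : ℝ) (C : (ℝ → ℝ) → Prop) (w : ℝ → ℝ) : Prop :=
  (IsODESolution μ 1 q w ∧ HasLeastPeriod w T ∧ C w) ∧
    ∀ v, IsODESolution μ 1 q v → HasLeastPeriod v T → C v → IsTimeShift v w

lemma exists_isUniqueSolution_of_strictMonoOn_period (hq : 0 < q) {P : ℝ → ℝ} {a b T : ℝ}
    (hab : a ≤ b) (hmono : StrictMonoOn P (Icc a b)) (hcont : ContinuousOn P (Icc a b))
    {C : (ℝ → ℝ) → Prop} {W : ℝ → ℝ → ℝ}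
    (hW : ∀ c ∈ Ioo a b, IsNewtonSolution (force q) (W c) ∧ C (W c) ∧ HasLeastPeriod (W c) (P c))
    (hT : T ∈ Ioo (P a) (P b))
    (hall : ∀ v, IsNewtonSolution (force q) v → C v → HasLeastPeriod v T →
      ∃ c ∈ Ioo a b, IsTimeShift v (W c)) :
    ∃ w, IsUniqueSolution 1 q T C w := by
  obtain ⟨w, ⟨⟨hw, hwC⟩, hwT⟩, huniq⟩ := existsUnique_of_strictMonoOn_period hab hmono hcont
    (C := fun w => IsNewtonSolution (force q) w ∧ C w) (W := W)
    (fun c hc => ⟨⟨(hW c hc).1, (hW c hc).2.1⟩, (hW c hc).2.2⟩) hT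
    fun v hv hvT => hall v hv.1 hv.2 hvT
  exact ⟨w, ⟨(isODESolution_iff hq).2 hw, hwT, hwC⟩,
    fun v hv hvT hvC => huniq v ⟨(isODESolution_iff hq).1 hv, hvC⟩ hvT⟩

section SignChanging

variable {v : ℝ → ℝ}

lemma exists_oscillation_family (hq0 : 0 < q) (hq1 : q < 1) : ∃ W : ℝ → ℝ → ℝ,
    (∀ c ∈ Ioo (0 : ℝ) 1, IsNewtonSolution (force q) (W c) ∧ IsSignChanging (W c) ∧
      HasLeastPeriod (W c) (4 * quarterPeriod q c)) ∧
    ∀ v, IsNewtonSolution (force q) v → 0 < energy (potential q) (v 0) (deriv v 0) →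
      ∃ c ∈ Ioo (0 : ℝ) 1, IsTimeShift v (W c) := by
  choose! W hW hsign horbit hleast using fun c => exists_oscillation hq0 hq1 (c := c)
  refine ⟨W, fun c hc => ⟨hW c hc, hsign c hc, hleast c hc⟩, fun v hv hE => ?_⟩
  obtain ⟨c, hc, hce⟩ := exists_potential_amplitude_eq hq0 hq1 hE
  exact ⟨c, hc, isTimeShift_of_energy_ne_zero hq0 hv (hW c hc) hE.ne' (horbit c hc ▸ hce.symm)⟩

lemma four_mul_quarterPeriod_mem_Ioo (hq0 : 0 < q) (hq1 : q < 1) {c : ℝ} (hc : c ∈ Ioo 0 1) :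
    4 * quarterPeriod q c ∈ Ioo (2 * π) (2 * bumpPeriod q) := by
  have hmono := strictMonoOn_quarterPeriod hq0 hq1
  have hlow := hmono (left_mem_Icc.2 zero_le_one) (Ioo_subset_Icc_self hc) hc.1
  have hup := hmono (Ioo_subset_Icc_self hc) (right_mem_Icc.2 zero_le_one) hc.2
  rw [quarterPeriod_zero] at hlow
  rw [(integrable_and_quarterPeriod_one hq1).2] at hup
  rw [bumpPeriod, mul_div_assoc]
  constructor <;> linarith

lemma energy_pos_of_isSignChanging (hq0 : 0 < q) (hq1 : q < 1)
    (hv : IsNewtonSolution (force q) v) (hsign : IsSignChanging v) {S : ℝ}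
    (hS : S ∈ Ioo 0 (2 * bumpPeriod q)) (hper : Function.Periodic v S) :
    0 < energy (potential q) (v 0) (deriv v 0) := by
  obtain ⟨⟨a, ha⟩, b, hb⟩ := hsign
  obtain ⟨t₀, ht₀⟩ : ∃ t, v t = 0 :=
    mem_range_of_exists_le_of_exists_ge hv.continuous ⟨b, hb.le⟩ ⟨a, ha.le⟩
  have hnonneg : 0 ≤ energy (potential q) (v 0) (deriv v 0) := by
    rw [energy_eq hq0 hv 0 t₀, ht₀, energy, potential_zero hq0]
    positivity
  refine hnonneg.lt_of_ne' fun hE => hS.2.not_ge ?_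
  obtain ⟨α, hα⟩ := exists_eqOn_bump hq0 hq1 hv (hE ▸ energy_eq hq0 hv a 0) ha
  have hv' := neg_isNewtonSolution hv
  have hE' : energy (potential q) ((-v) 0) (deriv (-v) 0) = 0 := by
    simpa only [Pi.neg_apply, deriv.neg, energy, potential_neg, neg_sq] using hE
  obtain ⟨β, hβ⟩ := exists_eqOn_bump hq0 hq1 hv' (hE' ▸ energy_eq hq0 hv' b 0) (neg_pos.2 hb)
  refine two_mul_le_of_periodic_of_pos_of_neg hS.1 hper (α := α) (β := β) (fun t ht => ?_)
    fun t ht => neg_pos.1 ?_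
  · exact (bump_pos hq0 hq1 ⟨sub_pos.2 ht.1, sub_lt_iff_lt_add'.2 ht.2⟩).trans_eq
      (hα (Ioo_subset_Icc_self ht)).symm
  · exact (bump_pos hq0 hq1 ⟨sub_pos.2 ht.1, sub_lt_iff_lt_add'.2 ht.2⟩).trans_eq
      (hβ (Ioo_subset_Icc_self ht)).symm

theorem two_pi_lt_of_isSignChanging (hq0 : 0 < q) (hq1 : q < 1)
    (hv : IsNewtonSolution (force q) v) (hsign : IsSignChanging v) {S : ℝ} (hS : 0 < S)
    (hper : Function.Periodic v S) : 2 * π < S := by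
  by_contra! hle
  have hlong : 2 * π < 2 * bumpPeriod q := by
    have h := four_mul_quarterPeriod_mem_Ioo hq0 hq1 ⟨one_half_pos, one_half_lt_one⟩
    exact h.1.trans h.2
  obtain ⟨W, hW, hall⟩ := exists_oscillation_family hq0 hq1
  obtain ⟨c, hc, hvW⟩ := hall v hv
    (energy_pos_of_isSignChanging hq0 hq1 hv hsign ⟨hS, hle.trans_lt hlong⟩ hper)
  have hleast : 4 * quarterPeriod q c ≤ S := (hvW.hasLeastPeriod (hW c hc).2.2).2 ⟨hS, hper⟩
  linarith [(four_mul_quarterPeriod_mem_Ioo hq0 hq1 hc).1]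

theorem exists_isUniqueSolution_signChanging (hq0 : 0 < q) (hq1 : q < 1) {T : ℝ}
    (hT : T ∈ Ioo (2 * π) (2 * bumpPeriod q)) : ∃ w, IsUniqueSolution 1 q T IsSignChanging w := by
  obtain ⟨W, hW, hall⟩ := exists_oscillation_family hq0 hq1
  refine exists_isUniqueSolution_of_strictMonoOn_period hq0 zero_le_one
    (P := fun c => 4 * quarterPeriod q c)
    ((strictMono_mul_left_of_pos four_pos).comp_strictMonoOn (strictMonoOn_quarterPeriod hq0 hq1))
    (continuousOn_const.mul (continuousOn_quarterPeriod hq0 hq1)) hW ?_ fun v hv hsign hvT => ?_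
  · rw [quarterPeriod_zero, (integrable_and_quarterPeriod_one hq1).2]
    convert hT using 2
    · ring
    · rw [bumpPeriod]
      ring
  · exact hall v hv (energy_pos_of_isSignChanging hq0 hq1 hv hsign ⟨hvT.1.1, hT.2⟩ hvT.1.2)

end SignChanging

section Positive

variable {v : ℝ → ℝ}

lemma energy_neg_of_pos (hq0 : 0 < q) (hq1 : q < 1) (hv : IsNewtonSolution (force q) v)
    (hpos : ∀ t, 0 < v t) : energy (potential q) (v 0) (deriv v 0) < 0 := by
  by_contra! hE
  rcases hE.eq_or_lt with hE | hE
  · obtain ⟨σ, hσ⟩ := exists_eqOn_bump hq0 hq1 hv hE.symm (hpos 0)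
    have hvσ := hσ (left_mem_Icc.2 (by linarith [bumpPeriod_pos hq1]))
    simp only [sub_self, bump_zero hq1] at hvσ
    exact (hpos σ).ne' hvσ
  · obtain ⟨W, hW, hall⟩ := exists_oscillation_family hq0 hq1
    obtain ⟨c, hc, hvW⟩ := hall v hv hE
    obtain ⟨τ, hτ⟩ := hvW.symm
    obtain ⟨t, ht⟩ := (hW c hc).2.1.2
    exact ht.not_gt (hτ t ▸ hpos (t + τ))

lemma exists_radius (hq0 : 0 < q) (hq1 : q < 1) (hv : IsNewtonSolution (force q) v)
    (hpos : ∀ t, 0 < v t) (hnc : ¬ IsConstantFun v) :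
    ∃ r ∈ Ioo 0 (wellRadius (potential q) 0 1),
      energy (potential q) (v 0) (deriv v 0) = potential q 1 + r ^ 2 / 2 := by
  have hU := isPotentialWell hq0 hq1
  have hneg := energy_neg_of_pos hq0 hq1 hv hpos
  have hgt : potential q 1 < energy (potential q) (v 0) (deriv v 0) := by
    by_contra! hle
    refine hnc ⟨1, fun t => ?_⟩
    by_contra hne
    have hpot := hU.potential_lt (hpos t).le hne
    rw [energy_eq hq0 hv 0 t, energy] at hle
    linarith [sq_nonneg (deriv v t)]
  have hrad := hU.wellRadius_sq
  rw [potential_zero hq0] at hrad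
  refine ⟨√(2 * (energy (potential q) (v 0) (deriv v 0) - potential q 1)),
    ⟨sqrt_pos.2 (by linarith), (sqrt_lt' hU.wellRadius_pos).2 (by linarith)⟩, ?_⟩
  rw [sq_sqrt (by linarith)]
  ring

lemma exists_well_family (hq0 : 0 < q) (hq1 : q < 1) : ∃ W : ℝ → ℝ → ℝ,
    (∀ r ∈ Ioo 0 (wellRadius (potential q) 0 1), IsNewtonSolution (force q) (W r) ∧
      (∀ t, 0 < W r t) ∧ HasLeastPeriod (W r) (2 * wellHalfPeriod (potential q) 0 1 r)) ∧
    ∀ v, IsNewtonSolution (force q) v → (∀ t, 0 < v t) → ¬ IsConstantFun v →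
      ∃ r ∈ Ioo 0 (wellRadius (potential q) 0 1), IsTimeShift v (W r) := by
  choose! W hW horbit hleast using fun r => (isPotentialWell hq0 hq1).exists_periodic (r := r)
  refine ⟨W, fun r hr => ⟨hW r hr, fun t => ?_, hleast r hr⟩, fun v hv hpos hnc => ?_⟩
  · have hmem : (W r t, deriv (W r) t) ∈ phaseOrbit (W r) := ⟨t, rfl⟩
    rw [horbit r hr] at hmem
    exact hmem.1
  · obtain ⟨r, hr, hE⟩ := exists_radius hq0 hq1 hv hpos hnc
    exact ⟨r, hr, isTimeShift_of_energy_ne_zero hq0 hv (hW r hr)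
      (energy_neg_of_pos hq0 hq1 hv hpos).ne (horbit r hr ▸ ⟨hpos 0, hE⟩)⟩

lemma two_mul_wellHalfPeriod_zero (hq0 : 0 < q) (hq1 : q < 1) :
    2 * wellHalfPeriod (potential q) 0 1 0 = 2 * π / √(1 - q) := by
  rw [(isPotentialWell hq0 hq1).wellHalfPeriod_zero, mul_div_assoc]

lemma two_mul_wellHalfPeriod_wellRadius (hq0 : 0 < q) (hq1 : q < 1) :
    2 * wellHalfPeriod (potential q) 0 1 (wellRadius (potential q) 0 1) = bumpPeriod q := by
  rw [(integrable_and_wellHalfPeriod_one hq0 hq1).2, bumpPeriod, mul_div_assoc]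

theorem exists_hasLeastPeriod_of_pos (hq0 : 0 < q) (hq1 : q < 1)
    (hv : IsNewtonSolution (force q) v) (hpos : ∀ t, 0 < v t) (hnc : ¬ IsConstantFun v) :
    ∃ T ∈ Ioo (2 * π / √(1 - q)) (bumpPeriod q), HasLeastPeriod v T := by
  obtain ⟨W, hW, hall⟩ := exists_well_family hq0 hq1
  obtain ⟨r, hr, hvW⟩ := hall v hv hpos hnc
  have hmono := (strictMonoOn_and_continuousOn_positivePeriod hq0 hq1).1
  have hR := (isPotentialWell hq0 hq1).wellRadius_pos.le
  refine ⟨_, ⟨?_, ?_⟩, hvW.hasLeastPeriod (hW r hr).2.2⟩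
  · rw [← two_mul_wellHalfPeriod_zero hq0 hq1]
    exact mul_lt_mul_of_pos_left (hmono (left_mem_Icc.2 hR) (Ioo_subset_Icc_self hr) hr.1) two_pos
  · rw [← two_mul_wellHalfPeriod_wellRadius hq0 hq1]
    exact mul_lt_mul_of_pos_left (hmono (Ioo_subset_Icc_self hr) (right_mem_Icc.2 hR) hr.2) two_pos

theorem exists_isUniqueSolution_positive (hq0 : 0 < q) (hq1 : q < 1) {T : ℝ}
    (hT : T ∈ Ioo (2 * π / √(1 - q)) (bumpPeriod q)) :
    ∃ w, IsUniqueSolution 1 q T (fun w => ∀ t, 0 < w t) w := by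
  obtain ⟨W, hW, hall⟩ := exists_well_family hq0 hq1
  obtain ⟨hmono, hcont⟩ := strictMonoOn_and_continuousOn_positivePeriod hq0 hq1
  refine exists_isUniqueSolution_of_strictMonoOn_period hq0
    (isPotentialWell hq0 hq1).wellRadius_pos.le
    (P := fun r => 2 * wellHalfPeriod (potential q) 0 1 r)
    ((strictMono_mul_left_of_pos two_pos).comp_strictMonoOn hmono)
    (continuousOn_const.mul hcont) hW ?_ fun v hv hpos hvT => hall v hv hpos hvT.not_isConstantFun
  rwa [two_mul_wellHalfPeriod_zero hq0 hq1, two_mul_wellHalfPeriod_wellRadius hq0 hq1]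

end Positive

lemma isTimeShift_bump (hq0 : 0 < q) (hq1 : q < 1) {v : ℝ → ℝ}
    (hv : IsNewtonSolution (force q) v) (hnonneg : ∀ t, 0 ≤ v t)
    (hT : HasLeastPeriod v (bumpPeriod q)) : IsTimeShift v (bump q) := by
  obtain ⟨t₁, hzero⟩ : ∃ t, v t = 0 := by
    by_contra! hne
    obtain ⟨T, hT', hleast⟩ := exists_hasLeastPeriod_of_pos hq0 hq1 hv
      (fun t => (hnonneg t).lt_of_ne' (hne t)) hT.not_isConstantFun
    exact hT'.2.ne (hleast.unique hT)
  obtain ⟨t₀, ht₀⟩ : ∃ t, 0 < v t := by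
    by_contra! hle
    exact hT.not_isConstantFun ⟨0, fun t => (hle t).antisymm (hnonneg t)⟩
  have hE : energy (potential q) (v t₀) (deriv v t₀) = 0 := by
    rw [energy_eq hq0 hv t₀ t₁, hzero, deriv_eq_zero_of_nonneg hnonneg hzero, energy,
      potential_zero hq0]
    ring
  obtain ⟨σ, hσ⟩ := exists_eqOn_bump hq0 hq1 hv hE ht₀
  refine ⟨-σ, fun t => ?_⟩
  obtain ⟨n, hn, -⟩ := existsUnique_add_zsmul_mem_Ico (bumpPeriod_pos hq1) t σ
  have hper : Function.Periodic v (bumpPeriod q) := hT.1.2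
  calc v t = v (t + n • bumpPeriod q) := (hper.zsmul n t).symm
    _ = bump q (t + n • bumpPeriod q - σ) := hσ (Ico_subset_Icc_self hn)
    _ = bump q (t + -σ + n • bumpPeriod q) := by rw [add_right_comm, ← sub_eq_add_neg]
    _ = bump q (t + -σ) := (periodic_bump hq1).zsmul n _

theorem isUniqueSolution_bump (hq0 : 0 < q) (hq1 : q < 1) :
    IsUniqueSolution 1 q (bumpPeriod q) (fun w => ∀ t, 0 ≤ w t) (bump q) :=
  ⟨⟨(isODESolution_iff hq0).2 (isNewtonSolution_bump hq0 hq1), hasLeastPeriod_bump hq0 hq1,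
    bump_nonneg hq0⟩, fun _ hv hT hnonneg =>
      isTimeShift_bump hq0 hq1 ((isODESolution_iff hq0).1 hv) hnonneg hT⟩

section Rescale

/-- The amplitude factor that goes with the time change `t ↦ m t` in `rescale`. The exponent is
chosen so that its `(q - 1)`-st power is `m ^ 2`. -/
noncomputable def scaleFactor (q m : ℝ) : ℝ := m ^ (2 / (q - 1))

/-- The change of units that turns solutions of `w'' + μ w = ε w |w|^(q-1)` into solutions of the
equation with `m ^ 2 * μ` in place of `μ`. -/
noncomputable def rescale (q m : ℝ) (w : ℝ → ℝ) : ℝ → ℝ := fun t => scaleFactor q m * w (m * t)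

/-- The class `C` of functions is invariant under all changes of units. -/
def IsRescaleInvariant (q : ℝ) (C : (ℝ → ℝ) → Prop) : Prop :=
  ∀ ⦃m : ℝ⦄, 0 < m → ∀ ⦃w : ℝ → ℝ⦄, C w → C (rescale q m w)

variable {m T : ℝ} {v w : ℝ → ℝ}

lemma scaleFactor_pos (hm : 0 < m) : 0 < scaleFactor q m :=
  rpow_pos_of_pos hm _

lemma scaleFactor_rpow (hq : q ≠ 1) (hm : 0 < m) : scaleFactor q m ^ (q - 1) = m ^ 2 := by
  rw [scaleFactor, ← rpow_mul hm.le, div_mul_cancel₀ _ (sub_ne_zero.2 hq), rpow_two]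

lemma rescale_rescale_inv (hm : 0 < m) (w : ℝ → ℝ) : rescale q m (rescale q m⁻¹ w) = w := by
  funext t
  rw [rescale, rescale, scaleFactor, scaleFactor, inv_rpow hm.le, inv_mul_cancel_left₀ hm.ne',
    mul_inv_cancel_left₀ (rpow_pos_of_pos hm _).ne']

lemma deriv_rescale (q m : ℝ) (w : ℝ → ℝ) (t : ℝ) :
    deriv (rescale q m w) t = scaleFactor q m * m * deriv w (m * t) := by
  unfold rescale
  rw [deriv_const_mul_field, deriv_comp_mul_left, smul_eq_mul, mul_assoc]

theorem isODESolution_rescale (hq : q ≠ 1) (hm : 0 < m) {μ ε : ℝ} (hw : IsODESolution μ ε q w) :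
    IsODESolution (m ^ 2 * μ) ε q (rescale q m w) := by
  refine ⟨contDiff_const.mul (hw.1.comp (contDiff_const.mul contDiff_id)), fun t => ?_⟩
  have hderiv : deriv (rescale q m w) = fun t => scaleFactor q m * m * deriv w (m * t) :=
    funext (deriv_rescale q m w)
  have hderiv₂ : deriv (deriv (rescale q m w)) t
      = scaleFactor q m * m ^ 2 * deriv (deriv w) (m * t) := by
    rw [hderiv, deriv_const_mul_field, deriv_comp_mul_left, smul_eq_mul]
    ring
  rw [hderiv₂, rescale, abs_mul, abs_of_pos (scaleFactor_pos hm),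
    mul_rpow (scaleFactor_pos hm).le (abs_nonneg _), scaleFactor_rpow hq hm]
  linear_combination scaleFactor q m * m ^ 2 * hw.2 (m * t)

lemma periodic_rescale_iff (hm : 0 < m) {S : ℝ} :
    Function.Periodic (rescale q m w) S ↔ Function.Periodic w (m * S) := by
  refine ⟨fun h t => ?_, fun h t => ?_⟩
  · have hS := h (t / m)
    simp only [rescale, mul_add, mul_div_cancel₀ t hm.ne'] at hS
    exact mul_left_cancel₀ (scaleFactor_pos hm).ne' hS
  · simp only [rescale, mul_add, h (m * t)]

lemma hasLeastPeriod_rescale (hm : 0 < m) (h : HasLeastPeriod w T) :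
    HasLeastPeriod (rescale q m w) (T / m) := by
  refine ⟨⟨div_pos h.1.1 hm, ?_⟩, fun S hS => ?_⟩
  · rw [periodic_rescale_iff hm, mul_div_cancel₀ T hm.ne']
    exact h.1.2
  · rw [div_le_iff₀' hm]
    exact h.2 ⟨mul_pos hm hS.1, (periodic_rescale_iff hm).1 hS.2⟩

lemma isTimeShift_rescale (hm : 0 < m) (h : IsTimeShift v w) :
    IsTimeShift (rescale q m v) (rescale q m w) := by
  obtain ⟨τ, hτ⟩ := h
  refine ⟨τ / m, fun t => ?_⟩
  rw [rescale, rescale, hτ, mul_add, mul_div_cancel₀ _ hm.ne']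

lemma isRescaleInvariant_isSignChanging : IsRescaleInvariant q IsSignChanging := by
  rintro m hm w ⟨⟨s, hs⟩, t, ht⟩
  refine ⟨⟨s / m, ?_⟩, t / m, ?_⟩ <;> rw [rescale, mul_div_cancel₀ _ hm.ne']
  · exact mul_pos (scaleFactor_pos hm) hs
  · exact mul_neg_of_pos_of_neg (scaleFactor_pos hm) ht

lemma isRescaleInvariant_pos : IsRescaleInvariant q fun w => ∀ t, 0 < w t :=
  fun _ hm _ hw _ => mul_pos (scaleFactor_pos hm) (hw _)

lemma isRescaleInvariant_nonneg : IsRescaleInvariant q fun w => ∀ t, 0 ≤ w t :=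
  fun _ hm _ hw _ => mul_nonneg (scaleFactor_pos hm).le (hw _)

lemma isRescaleInvariant_not_isConstantFun : IsRescaleInvariant q fun w => ¬ IsConstantFun w := by
  rintro m hm w hw ⟨b, hb⟩
  refine hw ⟨b / scaleFactor q m, fun t => ?_⟩
  rw [eq_div_iff (scaleFactor_pos hm).ne', ← hb (t / m), rescale, mul_div_cancel₀ _ hm.ne',
    mul_comm]

lemma mem_phaseOrbit_rescale_iff (hm : 0 < m) {x y : ℝ} :
    (scaleFactor q m * x, scaleFactor q m * m * y) ∈ phaseOrbit (rescale q m w) ↔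
      (x, y) ∈ phaseOrbit w := by
  have ha := scaleFactor_pos (q := q) hm
  simp only [phaseOrbit, mem_range, Prod.mk.injEq, deriv_rescale,
    mul_right_inj' (mul_pos ha hm).ne']
  simp only [rescale, mul_right_inj' ha.ne']
  exact ((mul_left_surjective₀ hm.ne').exists
    (p := fun s => w s = x ∧ deriv w s = y)).symm

theorem isUniqueSolution_rescale (hq : q ≠ 1) (hm : 0 < m) {C : (ℝ → ℝ) → Prop}
    (hC : IsRescaleInvariant q C) {μ : ℝ} (hw : IsUniqueSolution μ q T C w) :
    IsUniqueSolution (m ^ 2 * μ) q (T / m) C (rescale q m w) := by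
  obtain ⟨⟨hODE, hT, hCw⟩, huniq⟩ := hw
  refine ⟨⟨isODESolution_rescale hq hm hODE, hasLeastPeriod_rescale hm hT, hC hm hCw⟩,
    fun v hv hvT hvC => ?_⟩
  have hm' := inv_pos.2 hm
  have hv' := isODESolution_rescale hq hm' hv
  have hvT' := hasLeastPeriod_rescale (q := q) hm' hvT
  rw [inv_pow, inv_mul_cancel_left₀ (by positivity)] at hv'
  rw [div_inv_eq_mul, div_mul_cancel₀ _ hm.ne'] at hvT'
  rw [← rescale_rescale_inv (q := q) hm v]
  exact isTimeShift_rescale hm (huniq _ hv' hvT' (hC hm' hvC))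

end Rescale

section General

variable {μ T : ℝ} {w : ℝ → ℝ} {k : ℕ}

lemma IsUniqueSolution.rescale_sqrt (hμ : 0 < μ) (hq : q ≠ 1) {C : (ℝ → ℝ) → Prop}
    (hC : IsRescaleInvariant q C) (hw : IsUniqueSolution 1 q (√μ * T) C w) :
    IsUniqueSolution μ q T C (rescale q (√μ) w) := by
  have h := isUniqueSolution_rescale hq (sqrt_pos.2 hμ) hC hw
  rwa [sq_sqrt hμ.le, mul_one, mul_div_cancel_left₀ _ (sqrt_pos.2 hμ).ne'] at h

lemma isNewtonSolution_rescale_inv_sqrt (hμ : 0 < μ) (hq0 : 0 < q) (hq1 : q < 1)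
    (hw : IsODESolution μ 1 q w) : IsNewtonSolution (force q) (rescale q (√μ)⁻¹ w) := by
  have h := isODESolution_rescale hq1.ne (inv_pos.2 (sqrt_pos.2 hμ)) hw
  rwa [inv_pow, sq_sqrt hμ.le, inv_mul_cancel₀ hμ.ne', isODESolution_iff hq0] at h

theorem exists_isUniqueSolution_signChanging_mode (hμ : 0 < μ) (hq0 : 0 < q) (hq1 : q < 1)
    (hlow : (1 - q) / 2 * √μ < k) (hup : (k : ℝ) < √μ) :
    ∃ w, IsUniqueSolution μ q (2 * π / k) IsSignChanging w := by
  have hδ : 0 < 1 - q := sub_pos.2 hq1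
  have hk : 0 < (k : ℝ) := hlow.trans_le' (by positivity)
  have hT : √μ * (2 * π / k) ∈ Ioo (2 * π) (2 * bumpPeriod q) := by
    rw [bumpPeriod, mul_div_assoc', mul_div_assoc', mem_Ioo, lt_div_iff₀ hk, div_lt_div_iff₀ hk hδ]
    constructor <;> nlinarith [two_pi_pos]
  obtain ⟨w, hw⟩ := exists_isUniqueSolution_signChanging hq0 hq1 hT
  exact ⟨_, hw.rescale_sqrt hμ hq1.ne isRescaleInvariant_isSignChanging⟩

lemma exists_nat_mem_Ioo_mul {c x : ℝ} (hc0 : 0 ≤ c) (hc : c < 1 / 2) (hx : 1 < x) :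
    ∃ k : ℕ, c * x < k ∧ (k : ℝ) < x := by
  rcases lt_or_ge (c * x) 1 with hlt | hge
  · exact ⟨1, by rwa [Nat.cast_one], by rwa [Nat.cast_one]⟩
  · refine ⟨⌊c * x⌋₊ + 1, mod_cast Nat.lt_floor_add_one (c * x), ?_⟩
    have hfloor := Nat.floor_le (zero_le_one.trans hge)
    push_cast
    nlinarith

theorem exists_signChanging_periodic_iff (hμ : 0 < μ) (hq0 : 0 < q) (hq1 : q < 1) :
    (∃ w : ℝ → ℝ, IsODESolution μ 1 q w ∧ Function.Periodic w (2 * π) ∧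
        ¬ IsConstantFun w ∧ IsSignChanging w) ↔ 1 < μ := by
  have hm : 0 < √μ := sqrt_pos.2 hμ
  have hiff : 1 < √μ ↔ 1 < μ := by rw [lt_sqrt zero_le_one, one_pow]
  rw [← hiff]
  constructor
  · rintro ⟨w, hw, hper, -, hsign⟩
    have hlt := two_pi_lt_of_isSignChanging hq0 hq1
      (isNewtonSolution_rescale_inv_sqrt hμ hq0 hq1 hw)
      (isRescaleInvariant_isSignChanging (inv_pos.2 hm) hsign) (mul_pos hm two_pi_pos)
      ((periodic_rescale_iff (inv_pos.2 hm)).2 (by rwa [inv_mul_cancel_left₀ hm.ne']))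
    exact (lt_mul_iff_one_lt_left two_pi_pos).1 hlt
  · intro hlt
    obtain ⟨k, hlow, hup⟩ := exists_nat_mem_Ioo_mul (c := (1 - q) / 2) (by linarith)
      (by linarith) hlt
    obtain ⟨w, ⟨hw, hk, hsign⟩, -⟩ :=
      exists_isUniqueSolution_signChanging_mode hμ hq0 hq1 hlow hup
    exact ⟨w, hw, IsOfMode.periodic hk, hk.not_isConstantFun, hsign⟩

lemma sqrt_mul_mem_Ioo_iff (hμ : 0 < μ) (hq1 : q < 1) {k : ℝ} (hk : 0 < k) :
    √μ * (2 * π / k) ∈ Ioo (2 * π / √(1 - q)) (bumpPeriod q) ↔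
      (1 - q) * √μ < k ∧ k < √(μ * (1 - q)) := by
  have hδ : 0 < 1 - q := sub_pos.2 hq1
  rw [bumpPeriod, mul_div_left_comm, mem_Ioo, div_eq_mul_inv, div_eq_mul_inv _ (1 - q),
    mul_lt_mul_iff_right₀ two_pi_pos, mul_lt_mul_iff_right₀ two_pi_pos, inv_eq_one_div,
    inv_eq_one_div, div_lt_div_iff₀ (sqrt_pos.2 hδ) hk, div_lt_div_iff₀ hk hδ, one_mul,
    sqrt_mul hμ.le, and_comm, mul_comm (1 - q)]

theorem exists_isUniqueSolution_positive_mode (hμ : 0 < μ) (hq0 : 0 < q) (hq1 : q < 1)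
    (hlow : (1 - q) * √μ < k) (hup : (k : ℝ) < √(μ * (1 - q))) :
    ∃ w, IsUniqueSolution μ q (2 * π / k) (fun w => ∀ t, 0 < w t) w := by
  have hk : 0 < (k : ℝ) := hlow.trans' (mul_pos (sub_pos.2 hq1) (sqrt_pos.2 hμ))
  obtain ⟨w, hw⟩ := exists_isUniqueSolution_positive hq0 hq1
    ((sqrt_mul_mem_Ioo_iff hμ hq1 hk).2 ⟨hlow, hup⟩)
  exact ⟨_, hw.rescale_sqrt hμ hq1.ne isRescaleInvariant_pos⟩

theorem exists_isOfMode_of_pos_of_periodic (hμ : 0 < μ) (hq0 : 0 < q) (hq1 : q < 1)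
    (hw : IsODESolution μ 1 q w) (hpos : ∀ t, 0 < w t) (hnc : ¬ IsConstantFun w)
    (hper : Function.Periodic w (2 * π)) :
    ∃ n : ℕ, IsOfMode w n ∧ (1 - q) * √μ < n ∧ (n : ℝ) < √(μ * (1 - q)) := by
  have hm : 0 < √μ := sqrt_pos.2 hμ
  obtain ⟨T, hT, hleast⟩ := exists_hasLeastPeriod_of_pos hq0 hq1
    (isNewtonSolution_rescale_inv_sqrt hμ hq0 hq1 hw) (isRescaleInvariant_pos (inv_pos.2 hm) hpos)
    (isRescaleInvariant_not_isConstantFun (inv_pos.2 hm) hnc)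
  have hwT := hasLeastPeriod_rescale (q := q) hm hleast
  rw [rescale_rescale_inv hm] at hwT
  obtain ⟨n, hn, hnT⟩ := hwT.exists_eq_nat_mul two_pi_pos hper
  have hn' : 0 < (n : ℝ) := by exact_mod_cast hn
  have hmode : T / √μ = 2 * π / n := by rw [hnT, mul_div_cancel_left₀ _ hn'.ne']
  rw [hmode] at hwT
  refine ⟨n, hwT, (sqrt_mul_mem_Ioo_iff hμ hq1 hn').1 ?_⟩
  rwa [← hmode, mul_div_cancel₀ _ hm.ne']

theorem exists_positive_mode_iff (hμ : 0 < μ) (hq0 : 0 < q) (hq1 : q < 1) (k : ℕ) :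
    (∃ w : ℝ → ℝ, IsODESolution μ 1 q w ∧ IsOfMode w k ∧ ∀ t, 0 < w t) ↔
      (1 - q) * √μ < k ∧ (k : ℝ) < √(μ * (1 - q)) := by
  constructor
  · rintro ⟨w, hw, hk, hpos⟩
    obtain ⟨n, hn, hmode⟩ := exists_isOfMode_of_pos_of_periodic hμ hq0 hq1 hw hpos
      (HasLeastPeriod.not_isConstantFun hk) (IsOfMode.periodic hk)
    rwa [IsOfMode.unique hk hn]
  · rintro ⟨hlow, hup⟩
    obtain ⟨w, hw, -⟩ := exists_isUniqueSolution_positive_mode hμ hq0 hq1 hlow hup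
    exact ⟨w, hw⟩

theorem exists_positive_periodic_iff (hμ : 0 < μ) (hq0 : 0 < q) (hq1 : q < 1) :
    (∃ w : ℝ → ℝ, IsODESolution μ 1 q w ∧ Function.Periodic w (2 * π) ∧
        ¬ IsConstantFun w ∧ ∀ t, 0 < w t) ↔
      ∃ k : ℕ, (1 - q) * √μ < k ∧ (k : ℝ) < √(μ * (1 - q)) := by
  constructor
  · rintro ⟨w, hw, hper, hnc, hpos⟩
    obtain ⟨n, -, hmode⟩ := exists_isOfMode_of_pos_of_periodic hμ hq0 hq1 hw hpos hnc hper
    exact ⟨n, hmode⟩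
  · rintro ⟨k, hlow, hup⟩
    obtain ⟨w, ⟨hw, hk, hpos⟩, -⟩ := exists_isUniqueSolution_positive_mode hμ hq0 hq1 hlow hup
    exact ⟨w, hw, IsOfMode.periodic hk, hk.not_isConstantFun, hpos⟩

lemma energy_eq_zero_iff_rescale {m : ℝ} (hm : 0 < m) (hq1 : q < 1) (x y : ℝ) :
    energy (potential q) x y = 0 ↔
      (scaleFactor q m * m * y) ^ 2 + m ^ 2 * (scaleFactor q m * x) ^ 2 =
        2 / (1 + q) * |scaleFactor q m * x| ^ (1 + q) := by
  have ha := scaleFactor_pos (q := q) hm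
  have hpow : scaleFactor q m ^ (1 + q) = scaleFactor q m ^ 2 * m ^ 2 := by
    rw [← scaleFactor_rpow hq1.ne hm, ← rpow_two, ← rpow_add ha]
    ring_nf
  have hkey : 2 * (scaleFactor q m * m) ^ 2 * energy (potential q) x y =
      (scaleFactor q m * m * y) ^ 2 + m ^ 2 * (scaleFactor q m * x) ^ 2 -
        2 / (1 + q) * |scaleFactor q m * x| ^ (1 + q) := by
    rw [abs_mul, abs_of_pos ha, mul_rpow ha.le (abs_nonneg _), hpow, energy, potential]
    ring
  rw [← sub_eq_zero (b := 2 / (1 + q) * _), ← hkey, mul_eq_zero, or_iff_right (by positivity)]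

lemma phaseOrbit_rescale_bump {m : ℝ} (hm : 0 < m) (hq0 : 0 < q) (hq1 : q < 1) :
    phaseOrbit (rescale q m (bump q)) =
      {p : ℝ × ℝ | 0 ≤ p.1 ∧ p.2 ^ 2 + m ^ 2 * p.1 ^ 2 = 2 / (1 + q) * |p.1| ^ (1 + q)} := by
  have ha := scaleFactor_pos (q := q) hm
  ext ⟨x, y⟩
  obtain ⟨x, rfl⟩ := mul_left_surjective₀ ha.ne' x
  obtain ⟨y, rfl⟩ := mul_left_surjective₀ (mul_pos ha hm).ne' y
  simp only [mem_phaseOrbit_rescale_iff hm, phaseOrbit_bump hq0 hq1, mem_ofPred_eq,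
    energy_eq_zero_iff_rescale hm hq1, mul_nonneg_iff_of_pos_left ha]

lemma existsUnique_rescale_bump_eq_zero {m : ℝ} (hm : 0 < m) (hq0 : 0 < q) (hq1 : q < 1) (a : ℝ) :
    ∃! t, t ∈ Ico a (a + bumpPeriod q / m) ∧ rescale q m (bump q) t = 0 := by
  have hiff : ∀ s, (s / m ∈ Ico a (a + bumpPeriod q / m) ∧ rescale q m (bump q) (s / m) = 0) ↔
      s ∈ Ico (m * a) (m * a + bumpPeriod q) ∧ bump q s = 0 := fun s => by
    rw [mem_Ico, mem_Ico, le_div_iff₀' hm, div_lt_iff₀' hm, mul_add, mul_div_cancel₀ _ hm.ne',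
      rescale, mul_div_cancel₀ _ hm.ne', mul_eq_zero, or_iff_right (scaleFactor_pos hm).ne']
  obtain ⟨s, hs, huniq⟩ := existsUnique_bump_eq_zero hq0 hq1 (m * a)
  refine ⟨s / m, (hiff s).2 hs, fun t ht => ?_⟩
  rw [← mul_div_cancel_left₀ t hm.ne', hiff] at ht
  rw [← huniq _ ht, mul_div_cancel_left₀ t hm.ne']

theorem isUniqueSolution_rescale_bump (hμ : 0 < μ) (hq0 : 0 < q) (hq1 : q < 1) :
    IsUniqueSolution μ q (bumpPeriod q / √μ) (fun w => ∀ t, 0 ≤ w t) (rescale q (√μ) (bump q)) := by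
  refine IsUniqueSolution.rescale_sqrt hμ hq1.ne isRescaleInvariant_nonneg ?_
  rw [mul_div_cancel₀ _ (sqrt_pos.2 hμ).ne']
  exact isUniqueSolution_bump hq0 hq1

end General

end SublinearOscillator

theorem proposition3p14 (μ q : ℝ) (hμ : 0 < μ) (hq0 : 0 < q) (hq1 : q < 1) :
    -- sign-changing solutions
    ((∃ w : ℝ → ℝ, IsODESolution μ 1 q w ∧ Function.Periodic w (2 * Real.pi) ∧
        ¬ IsConstantFun w ∧ IsSignChanging w) ↔ 1 < μ) ∧
    (∀ k : ℕ, (1 - q) / 2 * √μ < k → (k : ℝ) < √μ →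
      ∃ w : ℝ → ℝ, (IsODESolution μ 1 q w ∧ IsOfMode w k ∧ IsSignChanging w) ∧
        ∀ v : ℝ → ℝ, IsODESolution μ 1 q v → IsOfMode v k → IsSignChanging v →
          IsTimeShift v w ∨ IsTimeShift v (-w)) ∧
    -- positive solutions
    ((∃ w : ℝ → ℝ, IsODESolution μ 1 q w ∧ Function.Periodic w (2 * Real.pi) ∧
        ¬ IsConstantFun w ∧ ∀ t : ℝ, 0 < w t) ↔
      ∃ k : ℕ, (1 - q) * √μ < k ∧ (k : ℝ) < √(μ * (1 - q))) ∧
    (∀ k : ℕ, (∃ w : ℝ → ℝ, IsODESolution μ 1 q w ∧ IsOfMode w k ∧ ∀ t : ℝ, 0 < w t) ↔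
      (1 - q) * √μ < k ∧ (k : ℝ) < √(μ * (1 - q))) ∧
    (∀ k : ℕ, (1 - q) * √μ < k → (k : ℝ) < √(μ * (1 - q)) →
      ∃ w : ℝ → ℝ, (IsODESolution μ 1 q w ∧ IsOfMode w k ∧ ∀ t : ℝ, 0 < w t) ∧
        ∀ v : ℝ → ℝ, IsODESolution μ 1 q v → IsOfMode v k → (∀ t : ℝ, 0 < v t) →
          IsTimeShift v w) ∧
    -- the nonnegative solution with zeros
    (∃ w : ℝ → ℝ,
      (IsODESolution μ 1 q w ∧ HasLeastPeriod w (2 * Real.pi / ((1 - q) * √μ)) ∧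
        ∀ t : ℝ, 0 ≤ w t) ∧
      (∀ v : ℝ → ℝ, IsODESolution μ 1 q v →
        HasLeastPeriod v (2 * Real.pi / ((1 - q) * √μ)) → (∀ t : ℝ, 0 ≤ v t) →
          IsTimeShift v w) ∧
      (∀ a : ℝ, ∃! t : ℝ, t ∈ Set.Ico a (a + 2 * Real.pi / ((1 - q) * √μ)) ∧ w t = 0) ∧
      phaseOrbit w =
        {p : ℝ × ℝ | 0 ≤ p.1 ∧ p.2 ^ 2 + μ * p.1 ^ 2 = 2 / (1 + q) * |p.1| ^ (1 + q)}) := by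
  have hL : 2 * Real.pi / ((1 - q) * √μ) = SublinearOscillator.bumpPeriod q / √μ :=
    (div_div _ _ _).symm
  have horbit := SublinearOscillator.phaseOrbit_rescale_bump (Real.sqrt_pos.2 hμ) hq0 hq1
  rw [Real.sq_sqrt hμ.le] at horbit
  obtain ⟨hbump, hunique⟩ := SublinearOscillator.isUniqueSolution_rescale_bump hμ hq0 hq1
  refine ⟨SublinearOscillator.exists_signChanging_periodic_iff hμ hq0 hq1, fun k hlow hup => ?_,
    SublinearOscillator.exists_positive_periodic_iff hμ hq0 hq1,
    SublinearOscillator.exists_positive_mode_iff hμ hq0 hq1,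
    fun k => SublinearOscillator.exists_isUniqueSolution_positive_mode hμ hq0 hq1, ?_⟩
  · obtain ⟨w, hw, huniq⟩ :=
      SublinearOscillator.exists_isUniqueSolution_signChanging_mode hμ hq0 hq1 hlow hup
    exact ⟨w, hw, fun v hv hvk hsign => Or.inl (huniq v hv hvk hsign)⟩
  · rw [hL]
    exact ⟨_, hbump, hunique, SublinearOscillator.existsUnique_rescale_bump_eq_zero
      (Real.sqrt_pos.2 hμ) hq0 hq1, horbit⟩
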